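/- **Notation.** Let $\mathbf u=2^{-53}$. $\|\cdot\|_2$ and $\|\cdot\|_F$ are the spectral and the Frobenius norm, $\sigma_n(X)$ is the $n$-th greatest singular value of $X\in\mathbb R^{m\times n}$, and $\kappa_2(X)=\|X\|_2/\sigma_n(X)$. **Floating-point model.** Computed quantities are those of floating-point arithmetic in the standard model without overflow and underflow: every operation $+,-,\times,/,\sqrt{\ }$ returns its exact result times $1+\delta$ for some $|\delta|\le\mathbf u$. Sums may be evaluated in any order. **The algorithm.** $[Q,R]=\mathrm{SRCholeskyQR2}(X)$ with sketch matrix $\Omega\in\mathbb R^{s\times m}$ computes, in floating-point arithmetic, $$A=\Omega X,\quad G=A^\top A,\quad Y=\mathrm{Cholesky}(G),\quad W=XY^{-1},$$ $$C=W^\top W,\quad Z=\mathrm{Cholesky}(C),\quad Q=WZ^{-1},\quad R=ZY.$$ Here $\mathrm{Cholesky}$ returns the upper triangular factor, and the multiplications by $Y^{-1}$ and $Z^{-1}$ are done by substitution, row by row. A run breaks down if in one of the Cholesky factorizations a computed number under a square root is not positive. **Theorem 3.3.** Let $n\le s\le m$, $m\ge gn$ with $g\ge1$, and let $X\in\mathbb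 R^{m\times n}$ have rank $n$. Let $X$ be a $T_1$ matrix: for integers $0<v<n$ and $0\le t_2<t_1\le m$, there are $v$ columns of $X$ with at most $t_1$ non-zero entries each, and each of the other columns has at most $t_2$ non-zero entries. Let $0\le\epsilon<1$, and let $\Omega\in\mathbb R^{s\times m}$ be a random matrix (for example a Gaussian sketch) that is an $(\epsilon,p,n)$ oblivious $\ell_2$-subspace embedding, that is, for each fixed $n$-dimensional subspace $\mathcal K\subset\mathbb R^m$, with probability at least $1-p$, $$|\langle x,y\rangle-\langle\Omega x,\Omega y\rangle|\le\epsilon\|x\|_2\|y\|_2\quad\text{for all }x,y\in\mathcal K.$$ Assume $$mn\mathbf u\le\tfrac1{64},\qquad n(n+1)\mathbf u\le\tfrac1{64},\qquad \frac{\sqrt{1-\epsilon}}{\sqrt{1+\epsilon}}\ge\frac{32}{3}\sqrt{mn\mathbf u+n(n+1)\mathbf u}+\frac2{87}.$$ Put $c=\max_{i,j}|x_{ij}|$, $\eta=c/\|X\|_2$, $k_1=1.1\,m\mathbf u\cdot\sqrt s\,\|\Omega\|_2\cdot\sqrt{vt_1+nt_2}$, $$r_1=\min\Big(\frac{\sqrt{1-\epsilon}}{10.5\,\eta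 k_1},\ \frac1{10.5\,\eta\,(\sqrt{1+\epsilon}\sqrt{vt_1+nt_2}+k_1)}\sqrt{\frac{1-\epsilon}{s\mathbf u+(n+1)\mathbf u}}\Big),$$ $$b=\frac{1.16}{0.87\sqrt{\frac{1-\epsilon}{1+\epsilon}}-0.02},\qquad h=5b^2\,(mn\mathbf u+n(n+1)\mathbf u),$$ $$U_3=\frac{1.32+1.34\sqrt{1+h}}{\sqrt{1-\epsilon}}\big(\sqrt{1+\epsilon}\sqrt{vt_1+nt_2}+k_1\big)\,\eta\, n\sqrt n\,\mathbf u\|X\|_2+\frac{1.34\sqrt{1+h}}{\sqrt{1-\epsilon}}\big(\sqrt{1+\epsilon}+k_1\eta\big)\,n^2\mathbf u\|X\|_2 .$$ Then there is an event of probability at least $1-p$ such that, for every realization of $\Omega$ in this event that satisfies $\kappa_2(X)\le r_1$ (both $k_1$ and $r_1$ depend on $\Omega$ through $\|\Omega\|_2$), no run of $\mathrm{SRCholeskyQR2}(X)$ breaks down, and all computed $[Q,R]=\mathrm{SRCholeskyQR2}(X)$ satisfy $$\|Q^\top Q-I_n\|_F\le 5b^2\,(mn\mathbf u+n(n+1)\mathbf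 u),\qquad \|QR-X\|_F\le U_3 .$$ -/

import Mathlib

open Matrix MeasureTheory

noncomputable section

namespace RCholQR

/-! ### Matrix quantities -/

/-- The Frobenius norm. -/
def frobNorm {m n : ℕ} (A : Matrix (Fin m) (Fin n) ℝ) : ℝ :=
  √(∑ i, ∑ j, A i j ^ 2)

/-- The matrix 2-norm: the operator norm between Euclidean spaces. -/
def norm2 {m n : ℕ} (A : Matrix (Fin m) (Fin n) ℝ) : ℝ :=
  ‖LinearMap.toContinuousLinearMap (Matrix.toEuclideanLin A)‖

/-- `σ_n(X)`, the `n`-th greatest singular value of a matrix with `n ≥ 1` columns (Mathlib numbers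
singular values from `0`, in decreasing order). -/
def sigmaLast {m n : ℕ} (X : Matrix (Fin m) (Fin n) ℝ) : ℝ :=
  (Matrix.toEuclideanLin X).singularValues (n - 1)

/-- The condition number `κ₂(X) = ‖X‖₂ / σ_n(X)` (used for matrices of full column rank). -/
def cond2 {m n : ℕ} (X : Matrix (Fin m) (Fin n) ℝ) : ℝ :=
  norm2 X / sigmaLast X

/-- `c = max_{i,j} |x_ij|`. -/
def maxAbs {m n : ℕ} (X : Matrix (Fin m) (Fin n) ℝ) : ℝ :=
  ⨆ p : Fin m × Fin n, |X p.1 p.2|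

/-- `η = c / ‖X‖₂`. -/
def eta {m n : ℕ} (X : Matrix (Fin m) (Fin n) ℝ) : ℝ :=
  maxAbs X / norm2 X

/-- The number of non-zero entries in column `j`. -/
def colNnz {m n : ℕ} (X : Matrix (Fin m) (Fin n) ℝ) (j : Fin n) : ℕ :=
  (Finset.univ.filter fun i => X i j ≠ 0).card

/-- A sparse matrix of type `T₁`: there are `v > 0` dense columns, each having at most `t₁`
non-zero entries, and each of the remaining columns has at most `t₂` non-zero entries.
The informal `v ≪ n`, `t₂ ≪ t₁` are kept only as strict inequalities, and `t₁` close to `m`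
only as `t₁ ≤ m`. -/
structure IsT1 {m n : ℕ} (X : Matrix (Fin m) (Fin n) ℝ) (v t₁ t₂ : ℕ) : Prop where
  v_pos : 0 < v
  v_lt : v < n
  t₂_lt : t₂ < t₁
  t₁_le : t₁ ≤ m
  dense : ∃ D : Finset (Fin n), D.card = v ∧
    (∀ j ∈ D, colNnz X j ≤ t₁) ∧ (∀ j ∉ D, colNnz X j ≤ t₂)

/-! ### Sketching -/

/-- `S` is an `ε`-subspace embedding for `K`:
`|⟨x, y⟩ - ⟨S x, S y⟩| ≤ ε ‖x‖₂ ‖y‖₂` for all `x, y ∈ K`. -/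
def IsSubspaceEmbedding {s m : ℕ} (ε : ℝ) (S : Matrix (Fin s) (Fin m) ℝ)
    (K : Submodule ℝ (EuclideanSpace ℝ (Fin m))) : Prop :=
  ∀ x ∈ K, ∀ y ∈ K,
    |inner ℝ x y - inner ℝ (Matrix.toEuclideanLin S x) (Matrix.toEuclideanLin S y)|
      ≤ ε * ‖x‖ * ‖y‖

/-- The random matrix `Om` is an `(ε, p, n)` oblivious `ℓ₂`-subspace embedding: for each fixed
`n`-dimensional subspace `K`, it is an `ε`-subspace embedding for `K` with probability at
least `1 - p`. -/
def IsObliviousEmbedding {Ω' : Type*} [MeasurableSpace Ω'] (μ : Measure Ω') {s m : ℕ}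
    (Om : Ω' → Matrix (Fin s) (Fin m) ℝ) (ε p : ℝ) (n : ℕ) : Prop :=
  ∀ K : Submodule ℝ (EuclideanSpace ℝ (Fin m)), Module.finrank ℝ K = n →
    1 - p ≤ μ.real {ω | IsSubspaceEmbedding ε (Om ω) K}

/-! ### Floating-point arithmetic

The standard model of rounding error analysis (no overflow or underflow): each elementary operation
`+, -, *, /, √` returns the exact result times `1 + δ`, with some `|δ| ≤ u` that may differ from
operation to operation.  A computed quantity is therefore described by a relation: the relation
holds for every value that some admissible choice of the rounding errors produces. -/

/-- The machine precision `u = 2⁻⁵³` of double precision. -/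
def uRound : ℝ := (2 : ℝ)⁻¹ ^ 53

/-- `y` is an admissible floating-point rounding of the exact result `x` of one operation. -/
def Rounds (x y : ℝ) : Prop := ∃ δ : ℝ, |δ| ≤ uRound ∧ y = x * (1 + δ)

/-- `FlSum S z`: `z` is a floating-point value of the sum of the non-empty multiset `S`, the
terms being added in any order and with any bracketing, one rounding per addition. -/
inductive FlSum : Multiset ℝ → ℝ → Prop
  | single (a : ℝ) : FlSum {a} a
  | add {S T : Multiset ℝ} {x y z : ℝ} :
      FlSum S x → FlSum T y → Rounds (x + y) z → FlSum (S + T) z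

/-- `C` is a floating-point value of the matrix product `A * B`. -/
def FlMul {l m n : ℕ} (A : Matrix (Fin l) (Fin m) ℝ) (B : Matrix (Fin m) (Fin n) ℝ)
    (C : Matrix (Fin l) (Fin n) ℝ) : Prop :=
  ∀ i j, ∃ q : Fin m → ℝ, (∀ k, Rounds (A i k * B k j) (q k)) ∧
    FlSum (Finset.univ.val.map q) (C i j)

/-- `t` is a floating-point value of `a - ∑_{k < i} x_k y_k`. -/
def FlSubDot {n : ℕ} (a : ℝ) (i : Fin n) (x y : Fin n → ℝ) (t : ℝ) : Prop :=
  ∃ q : Fin n → ℝ, (∀ k < i, Rounds (x k * y k) (q k)) ∧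
    FlSum (a ::ₘ (Finset.Iio i).val.map fun k => -q k) t

/-- Row `i` of the upper triangular factor `R` is a successful floating-point evaluation of row `i`
of the Cholesky factor of `G`, from the rows `k < i` of `R`:
`r_ii = √(g_ii - ∑_{k<i} r_ki²)`, where the computed number under the root is positive, and
`r_ij = (g_ij - ∑_{k<i} r_ki r_kj) / r_ii` for `j > i`.
As usual, only the upper triangle of `G` is accessed. -/
def FlCholeskyRow {n : ℕ} (G R : Matrix (Fin n) (Fin n) ℝ) (i : Fin n) : Prop :=
  (∀ j < i, R i j = 0) ∧
  (∃ t, FlSubDot (G i i) i (fun k => R k i) (fun k => R k i) t ∧ 0 < t ∧ Rounds (√t) (R i i)) ∧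
  (∀ j, i < j →
    ∃ t, FlSubDot (G i j) i (fun k => R k i) (fun k => R k j) t ∧ Rounds (t / R i i) (R i j))

/-- `R` is a floating-point value of `Cholesky(G)`, `RᵀR = G`, from a run that completes. -/
def FlCholesky {n : ℕ} (G R : Matrix (Fin n) (Fin n) ℝ) : Prop :=
  ∀ i, FlCholeskyRow G R i

/-- Some floating-point run of `Cholesky(G)` breaks down: after the rows before `i` have been
computed successfully, the computed number under the root in row `i` is not positive. -/
def FlCholeskyBreaks {n : ℕ} (G : Matrix (Fin n) (Fin n) ℝ) : Prop :=
  ∃ (R : Matrix (Fin n) (Fin n) ℝ) (i : Fin n) (t : ℝ), (∀ k < i, FlCholeskyRow G R k) ∧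
    FlSubDot (G i i) i (fun k => R k i) (fun k => R k i) t ∧ t ≤ 0

/-- `W` is a floating-point value of `X Y⁻¹`, `Y` upper triangular, computed by substitution in
each row: `w_ij = (x_ij - ∑_{k<j} w_ik y_kj) / y_jj`. -/
def FlSolve {m n : ℕ} (X : Matrix (Fin m) (Fin n) ℝ) (Y : Matrix (Fin n) (Fin n) ℝ)
    (W : Matrix (Fin m) (Fin n) ℝ) : Prop :=
  ∀ i j, ∃ t, FlSubDot (X i j) j (fun k => W i k) (fun k => Y k j) t ∧ Rounds (t / Y j j) (W i j)

/-! ### The algorithms in floating-point arithmetic -/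

/-- The preconditioning step `A = ΩX`, `G = AᵀA`, `Y = Cholesky(G)`, `W = XY⁻¹`. -/
def FlPrecond {s m n : ℕ} (Om : Matrix (Fin s) (Fin m) ℝ) (X W : Matrix (Fin m) (Fin n) ℝ)
    (Y : Matrix (Fin n) (Fin n) ℝ) : Prop :=
  ∃ (A : Matrix (Fin s) (Fin n) ℝ) (G : Matrix (Fin n) (Fin n) ℝ),
    FlMul Om X A ∧ FlMul Aᵀ A G ∧ FlCholesky G Y ∧ FlSolve X Y W

/-- `[Q, Z] = CholeskyQR(W)`: `C = WᵀW`, `Z = Cholesky(C)`, `Q = WZ⁻¹`. -/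
def FlCholeskyQR {m n : ℕ} (W Q : Matrix (Fin m) (Fin n) ℝ)
    (Z : Matrix (Fin n) (Fin n) ℝ) : Prop :=
  ∃ C : Matrix (Fin n) (Fin n) ℝ, FlMul Wᵀ W C ∧ FlCholesky C Z ∧ FlSolve W Z Q

/-- `[Q, R] = SRCholeskyQR2(X)` with sketch matrix `Om`, computed by a run that completes:
the preconditioning step, `[Q, Z] = CholeskyQR(W)` and `R = ZY`. -/
def FlSRCholeskyQR2 {s m n : ℕ} (Om : Matrix (Fin s) (Fin m) ℝ) (X Q : Matrix (Fin m) (Fin n) ℝ)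
    (R : Matrix (Fin n) (Fin n) ℝ) : Prop :=
  ∃ (W : Matrix (Fin m) (Fin n) ℝ) (Y Z : Matrix (Fin n) (Fin n) ℝ),
    FlPrecond Om X W Y ∧ FlCholeskyQR W Q Z ∧ FlMul Z Y R

/-- Some floating-point run of `SRCholeskyQR2(X)` breaks down, in the first or in the second
Cholesky factorization. -/
def SRCholeskyQR2Breaks {s m n : ℕ} (Om : Matrix (Fin s) (Fin m) ℝ)
    (X : Matrix (Fin m) (Fin n) ℝ) : Prop :=
  (∃ (A : Matrix (Fin s) (Fin n) ℝ) (G : Matrix (Fin n) (Fin n) ℝ),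
    FlMul Om X A ∧ FlMul Aᵀ A G ∧ FlCholeskyBreaks G) ∨
  (∃ (W : Matrix (Fin m) (Fin n) ℝ) (Y C : Matrix (Fin n) (Fin n) ℝ),
    FlPrecond Om X W Y ∧ FlMul Wᵀ W C ∧ FlCholeskyBreaks C)

/-! ### The constants of the error bounds -/

/-- `mnu + n(n+1)u`. -/
def roundTerm (m n : ℕ) : ℝ := m * n * uRound + n * (n + 1) * uRound

/-- `k₁ = 1.1 m u · √s ‖Ω‖₂ · √(v t₁ + n t₂)`. -/
def kOne {s m : ℕ} (Om : Matrix (Fin s) (Fin m) ℝ) (n v t₁ t₂ : ℕ) : ℝ :=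
  1.1 * m * uRound * (√s * norm2 Om) * √(v * t₁ + n * t₂)

/-- `r₁`, the bound imposed on `κ₂(X)`. -/
def rOne {s m n : ℕ} (Om : Matrix (Fin s) (Fin m) ℝ) (X : Matrix (Fin m) (Fin n) ℝ)
    (ε : ℝ) (v t₁ t₂ : ℕ) : ℝ :=
  min (√(1 - ε) / (10.5 * eta X * kOne Om n v t₁ t₂))
    (1 / (10.5 * eta X * (√(1 + ε) * √(v * t₁ + n * t₂) + kOne Om n v t₁ t₂)) *
      √((1 - ε) / (s * uRound + (n + 1) * uRound)))

/-- `b = 1.16 / (0.87 √((1-ε)/(1+ε)) - 0.02)`. -/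
def bConst (ε : ℝ) : ℝ := 1.16 / (0.87 * √((1 - ε) / (1 + ε)) - 0.02)

/-- `h = 5 b² (mnu + n(n+1)u)`. -/
def hConst (m n : ℕ) (ε : ℝ) : ℝ := 5 * bConst ε ^ 2 * roundTerm m n

/-- `U₃`, the bound of the residual. -/
def uThree {s m n : ℕ} (Om : Matrix (Fin s) (Fin m) ℝ) (X : Matrix (Fin m) (Fin n) ℝ)
    (ε : ℝ) (v t₁ t₂ : ℕ) : ℝ :=
  (1.32 + 1.34 * √(1 + hConst m n ε)) / √(1 - ε) *
      (√(1 + ε) * √(v * t₁ + n * t₂) + kOne Om n v t₁ t₂) *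
      (eta X * n * √n * uRound * norm2 X) +
    1.34 * √(1 + hConst m n ε) / √(1 - ε) *
      (√(1 + ε) + kOne Om n v t₁ t₂ * eta X) * (n ^ 2 * uRound * norm2 X)

end RCholQR

end

noncomputable section

namespace RCholQR

/-! If `Ω` embeds the range of `X`, then `‖ΩXx‖` lies between `α‖Xx‖` and `β‖Xx‖`, where `α =
√(1-ε)` and `β = √(1+ε)`. So the exact Cholesky factor `Y` of `(ΩX)ᵀ(ΩX)` makes all singular values
of `XY⁻¹` lie in `[1/β, 1/α]`, however ill-conditioned `X` is. The proof shows that this survives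
rounding, and that CholeskyQR applied to the resulting well-conditioned `W` neither breaks down nor
loses orthogonality.

The condition on `κ₂(X)` says that the error of the computed sketch `A`, and the error of its
computed Gram matrix and Cholesky factor, are small against `α σ_n(X)` and its square
(`cond_le_rOne`, collected in `SketchBounds`). Since `σ_n(X)‖x‖ ≤ ‖Xx‖`, each error is then relative
to `‖Xx‖`, and `‖Yx‖` stays comparable with it (`le_factor`, `factor_le`). This yields `α‖W‖₂ ≤
1.13` and `0.87/β ≤ σ_n(W)` (`norm2_precond_le`, `le_precond_mulVec`), so `b` bounds the condition
number of `W`. Sparsity enters only through `‖X‖_F ≤ c √(vt₁ + nt₂)`.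

A breakdown is excluded by contradiction: the rows computed before the failure have a common kernel
vector, at which the quadratic form of the Gram matrix is of the size of rounding errors
(`FlCholeskyBreaks.exists_quadForm_le`), while a lower bound on the singular values forces it to be
larger. Orthogonality follows from `QᵀQ - 1 = Z⁻ᵀ(errors)Z⁻¹`, and the residual from splitting `QR -
X` into the backward errors of the two substitutions and of the product `ZY`. -/

/-! ### Euclidean, Frobenius and spectral norms -/

/-- The Euclidean norm of a coordinate vector. -/
def euclNorm {n : ℕ} (x : Fin n → ℝ) : ℝ := ‖WithLp.toLp 2 x‖

lemma euclNorm_sq {n : ℕ} (x : Fin n → ℝ) : euclNorm x ^ 2 = ∑ i, x i ^ 2 := by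
  simp [euclNorm, EuclideanSpace.norm_sq_eq]

lemma euclNorm_sq_eq_dotProduct {n : ℕ} (x : Fin n → ℝ) : euclNorm x ^ 2 = x ⬝ᵥ x := by
  rw [euclNorm_sq, dotProduct]
  exact Finset.sum_congr rfl fun i _ => sq _

lemma euclNorm_nonneg {n : ℕ} (x : Fin n → ℝ) : 0 ≤ euclNorm x := norm_nonneg _

lemma euclNorm_pos {n : ℕ} {x : Fin n → ℝ} (hx : x ≠ 0) : 0 < euclNorm x := by
  refine norm_pos_iff.2 fun h => hx ?_
  simpa using h

lemma euclNorm_add_le {n : ℕ} (x y : Fin n → ℝ) : euclNorm (x + y) ≤ euclNorm x + euclNorm y := by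
  simpa [euclNorm] using norm_add_le (WithLp.toLp 2 x) (WithLp.toLp 2 y)

lemma euclNorm_sub_le {n : ℕ} (x y : Fin n → ℝ) : euclNorm (x - y) ≤ euclNorm x + euclNorm y := by
  simpa [euclNorm] using norm_sub_le (WithLp.toLp 2 x) (WithLp.toLp 2 y)

lemma abs_dotProduct_le {n : ℕ} (x y : Fin n → ℝ) : |x ⬝ᵥ y| ≤ euclNorm x * euclNorm y := by
  have h := abs_real_inner_le_norm (WithLp.toLp 2 y) (WithLp.toLp 2 x)
  rw [EuclideanSpace.inner_eq_star_dotProduct] at h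
  simpa [euclNorm, mul_comm] using h

lemma sq_frobNorm {m n : ℕ} (A : Matrix (Fin m) (Fin n) ℝ) :
    frobNorm A ^ 2 = ∑ i, ∑ j, A i j ^ 2 :=
  Real.sq_sqrt (by positivity)

lemma frobNorm_nonneg {m n : ℕ} (A : Matrix (Fin m) (Fin n) ℝ) : 0 ≤ frobNorm A :=
  Real.sqrt_nonneg _

section Frobenius

attribute [local instance] Matrix.frobeniusNormedAddCommGroup

lemma frobNorm_eq_norm {m n : ℕ} (A : Matrix (Fin m) (Fin n) ℝ) : frobNorm A = ‖A‖ := by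
  rw [Matrix.frobenius_norm_def, frobNorm, Real.sqrt_eq_rpow]
  simp

lemma frobNorm_add_le {m n : ℕ} (A B : Matrix (Fin m) (Fin n) ℝ) :
    frobNorm (A + B) ≤ frobNorm A + frobNorm B := by
  simpa only [frobNorm_eq_norm] using norm_add_le A B

lemma frobNorm_sub_le {m n : ℕ} (A B : Matrix (Fin m) (Fin n) ℝ) :
    frobNorm (A - B) ≤ frobNorm A + frobNorm B := by
  simpa only [frobNorm_eq_norm] using norm_sub_le A B

lemma frobNorm_transpose {m n : ℕ} (A : Matrix (Fin m) (Fin n) ℝ) :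
    frobNorm Aᵀ = frobNorm A := by
  simpa only [frobNorm_eq_norm] using Matrix.frobenius_norm_transpose A

lemma frobNorm_mul_le {l m n : ℕ} (A : Matrix (Fin l) (Fin m) ℝ) (B : Matrix (Fin m) (Fin n) ℝ) :
    frobNorm (A * B) ≤ frobNorm A * frobNorm B := by
  simpa only [frobNorm_eq_norm] using Matrix.frobenius_norm_mul A B

end Frobenius

lemma sq_frobNorm_eq_sum_col {m n : ℕ} (A : Matrix (Fin m) (Fin n) ℝ) :
    frobNorm A ^ 2 = ∑ j, euclNorm (fun i => A i j) ^ 2 := by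
  rw [sq_frobNorm, Finset.sum_comm]
  simp only [euclNorm_sq]

lemma sq_frobNorm_eq_sum_row {m n : ℕ} (A : Matrix (Fin m) (Fin n) ℝ) :
    frobNorm A ^ 2 = ∑ i, euclNorm (A i) ^ 2 := by
  rw [sq_frobNorm]
  simp only [euclNorm_sq]

lemma sq_frobNorm_eq_trace {m n : ℕ} (A : Matrix (Fin m) (Fin n) ℝ) :
    frobNorm A ^ 2 = ∑ j, (Aᵀ * A) j j := by
  rw [sq_frobNorm, Finset.sum_comm]
  simp [Matrix.mul_apply, sq]

/-- The matrix of absolute values. -/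
def absM {m n : ℕ} (A : Matrix (Fin m) (Fin n) ℝ) : Matrix (Fin m) (Fin n) ℝ :=
  fun i j => |A i j|

lemma frobNorm_absM {m n : ℕ} (A : Matrix (Fin m) (Fin n) ℝ) : frobNorm (absM A) = frobNorm A := by
  simp [frobNorm, absM]

lemma absM_mul_apply {l m n : ℕ} (A : Matrix (Fin l) (Fin m) ℝ) (B : Matrix (Fin m) (Fin n) ℝ)
    (i : Fin l) (j : Fin n) : (absM A * absM B) i j = ∑ k, |A i k * B k j| := by
  simp [Matrix.mul_apply, absM, abs_mul]

lemma absM_mul_nonneg {l m n : ℕ} (A : Matrix (Fin l) (Fin m) ℝ) (B : Matrix (Fin m) (Fin n) ℝ)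
    (i : Fin l) (j : Fin n) : 0 ≤ (absM A * absM B) i j := by
  rw [absM_mul_apply]; positivity

lemma absM_transpose_mul_comm {m n : ℕ} (A : Matrix (Fin m) (Fin n) ℝ) (i j : Fin n) :
    (absM Aᵀ * absM A) i j = (absM Aᵀ * absM A) j i := by
  simp [absM_mul_apply, mul_comm]

lemma frobNorm_le_of_abs_le {m n : ℕ} {A B : Matrix (Fin m) (Fin n) ℝ} {c : ℝ} (hc : 0 ≤ c)
    (h : ∀ i j, |A i j| ≤ c * B i j) : frobNorm A ≤ c * frobNorm B := by
  refine Real.sqrt_le_iff.2 ⟨mul_nonneg hc (frobNorm_nonneg B), ?_⟩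
  rw [mul_pow, sq_frobNorm, Finset.mul_sum]
  refine Finset.sum_le_sum fun i _ => ?_
  rw [Finset.mul_sum]
  refine Finset.sum_le_sum fun j _ => ?_
  rw [← mul_pow]
  exact sq_le_sq.2 ((h i j).trans (le_abs_self _))

/-- Rounding bounds come entrywise against `|A||B|`; taking absolute values leaves the Frobenius
norm unchanged, so they turn into norm bounds without loss of a dimension factor. -/
lemma frobNorm_le_of_abs_le_mul {l m n : ℕ} {E : Matrix (Fin l) (Fin n) ℝ}
    {A : Matrix (Fin l) (Fin m) ℝ} {B : Matrix (Fin m) (Fin n) ℝ} {c : ℝ} (hc : 0 ≤ c)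
    (h : ∀ i j, |E i j| ≤ c * (absM A * absM B) i j) :
    frobNorm E ≤ c * (frobNorm A * frobNorm B) := by
  refine (frobNorm_le_of_abs_le hc h).trans (mul_le_mul_of_nonneg_left ?_ hc)
  simpa only [frobNorm_absM] using frobNorm_mul_le (absM A) (absM B)

lemma euclNorm_mulVec_le_frobNorm {m n : ℕ} (A : Matrix (Fin m) (Fin n) ℝ) (x : Fin n → ℝ) :
    euclNorm (A *ᵥ x) ≤ frobNorm A * euclNorm x := by
  refine abs_le_of_sq_le_sq' ?_ (mul_nonneg (frobNorm_nonneg _) (euclNorm_nonneg _)) |>.2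
  rw [mul_pow, euclNorm_sq (A *ᵥ x), sq_frobNorm_eq_sum_row, Finset.sum_mul]
  refine Finset.sum_le_sum fun i _ => ?_
  rw [← mul_pow]
  refine sq_le_sq' ?_ ?_
  · exact (abs_le.1 (abs_dotProduct_le (A i) x)).1
  · exact (abs_le.1 (abs_dotProduct_le (A i) x)).2

lemma norm2_nonneg {m n : ℕ} (A : Matrix (Fin m) (Fin n) ℝ) : 0 ≤ norm2 A := norm_nonneg _

lemma euclNorm_mulVec_le {m n : ℕ} (A : Matrix (Fin m) (Fin n) ℝ) (x : Fin n → ℝ) :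
    euclNorm (A *ᵥ x) ≤ norm2 A * euclNorm x :=
  (LinearMap.toContinuousLinearMap (Matrix.toEuclideanLin A)).le_opNorm (WithLp.toLp 2 x)

lemma norm2_le {m n : ℕ} {A : Matrix (Fin m) (Fin n) ℝ} {c : ℝ} (hc : 0 ≤ c)
    (h : ∀ x, euclNorm (A *ᵥ x) ≤ c * euclNorm x) : norm2 A ≤ c :=
  ContinuousLinearMap.opNorm_le_bound _ hc fun x => h x.ofLp

lemma norm2_transpose {m n : ℕ} (A : Matrix (Fin m) (Fin n) ℝ) : norm2 Aᵀ = norm2 A := by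
  simpa [Matrix.l2_opNorm_def, norm2] using Matrix.l2_opNorm_conjTranspose A

lemma frobNorm_mul_le_norm2_left {l m n : ℕ} (A : Matrix (Fin l) (Fin m) ℝ)
    (B : Matrix (Fin m) (Fin n) ℝ) : frobNorm (A * B) ≤ norm2 A * frobNorm B := by
  refine abs_le_of_sq_le_sq' ?_ (mul_nonneg (norm2_nonneg _) (frobNorm_nonneg _)) |>.2
  rw [mul_pow, sq_frobNorm_eq_sum_col, sq_frobNorm_eq_sum_col B, Finset.mul_sum]
  refine Finset.sum_le_sum fun j _ => ?_
  rw [← mul_pow]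
  exact pow_le_pow_left₀ (euclNorm_nonneg _) (euclNorm_mulVec_le A fun k => B k j) 2

lemma frobNorm_mul_le_norm2_right {l m n : ℕ} (A : Matrix (Fin l) (Fin m) ℝ)
    (B : Matrix (Fin m) (Fin n) ℝ) : frobNorm (A * B) ≤ frobNorm A * norm2 B := by
  have h := frobNorm_mul_le_norm2_left Bᵀ Aᵀ
  rwa [← Matrix.transpose_mul, frobNorm_transpose, frobNorm_transpose, norm2_transpose,
    mul_comm] at h

lemma sq_frobNorm_one (n : ℕ) : frobNorm (1 : Matrix (Fin n) (Fin n) ℝ) ^ 2 = n := by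
  simp [sq_frobNorm, Matrix.one_apply]

lemma frobNorm_one (n : ℕ) : frobNorm (1 : Matrix (Fin n) (Fin n) ℝ) = √n := by
  rw [← sq_frobNorm_one, Real.sqrt_sq (frobNorm_nonneg _)]

lemma frobNorm_le_sqrt_cols {m n : ℕ} (A : Matrix (Fin m) (Fin n) ℝ) :
    frobNorm A ≤ √n * norm2 A := by
  have h := frobNorm_mul_le_norm2_left A (1 : Matrix (Fin n) (Fin n) ℝ)
  rwa [Matrix.mul_one, frobNorm_one, mul_comm] at h

lemma frobNorm_le_sqrt_rows {m n : ℕ} (A : Matrix (Fin m) (Fin n) ℝ) :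
    frobNorm A ≤ √m * norm2 A := by
  have h := frobNorm_mul_le_norm2_right (1 : Matrix (Fin m) (Fin m) ℝ) A
  rwa [Matrix.one_mul, frobNorm_one] at h

lemma dotProduct_gram {m n : ℕ} (A : Matrix (Fin m) (Fin n) ℝ) (x : Fin n → ℝ) :
    x ⬝ᵥ ((Aᵀ * A) *ᵥ x) = euclNorm (A *ᵥ x) ^ 2 := by
  rw [euclNorm_sq_eq_dotProduct, ← Matrix.mulVec_mulVec, Matrix.dotProduct_mulVec,
    Matrix.vecMul_transpose]

lemma abs_quadForm_le {n : ℕ} (E : Matrix (Fin n) (Fin n) ℝ) (x : Fin n → ℝ) :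
    |x ⬝ᵥ (E *ᵥ x)| ≤ frobNorm E * euclNorm x ^ 2 := by
  refine (abs_dotProduct_le _ _).trans ?_
  nlinarith [mul_le_mul_of_nonneg_left (euclNorm_mulVec_le_frobNorm E x) (euclNorm_nonneg x)]

/-- This is how an error between Gram matrices becomes a comparison of `‖Zx‖` with `‖Wx‖` for a
computed Cholesky factor `Z` of `WᵀW`, although the two matrices have different shapes. -/
lemma abs_sq_euclNorm_sub_le {l m n : ℕ} (A : Matrix (Fin l) (Fin n) ℝ)
    (B : Matrix (Fin m) (Fin n) ℝ) (x : Fin n → ℝ) :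
    |euclNorm (A *ᵥ x) ^ 2 - euclNorm (B *ᵥ x) ^ 2|
      ≤ frobNorm (Aᵀ * A - Bᵀ * B) * euclNorm x ^ 2 := by
  rw [← dotProduct_gram, ← dotProduct_gram, ← dotProduct_sub, ← Matrix.sub_mulVec]
  exact abs_quadForm_le _ x

/-! ### The smallest singular value -/

lemma finrank_range_toEuclideanLin {m n : ℕ} (X : Matrix (Fin m) (Fin n) ℝ) :
    Module.finrank ℝ (LinearMap.range (Matrix.toEuclideanLin X)) = X.rank := by
  rw [Matrix.toEuclideanLin_eq_toLin_orthonormal, ← Matrix.rank_eq_finrank_range_toLin]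

lemma sigmaLast_pos {m n : ℕ} {X : Matrix (Fin m) (Fin n) ℝ} (hn : 0 < n) (hr : X.rank = n) :
    0 < sigmaLast X := by
  rw [sigmaLast, LinearMap.singularValues_pos_iff_lt_finrank_range,
    finrank_range_toEuclideanLin, hr]
  omega

/-- Expand `x` in an eigenbasis of the adjoint of `X` composed with `X`: the eigenvalues are the
squared singular values, and index `n - 1` carries the least of them. -/
lemma sigmaLast_mul_le {m n : ℕ} (X : Matrix (Fin m) (Fin n) ℝ) (x : Fin n → ℝ) :
    sigmaLast X * euclNorm x ≤ euclNorm (X *ᵥ x) := by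
  set T := Matrix.toEuclideanLin X with hT
  have hfin : Module.finrank ℝ (EuclideanSpace ℝ (Fin n)) = n := by simp
  have hsym := T.isSymmetric_adjoint_comp_self
  set y : EuclideanSpace ℝ (Fin n) := WithLp.toLp 2 x
  refine abs_le_of_sq_le_sq' ?_ (euclNorm_nonneg _) |>.2
  have h1 : euclNorm (X *ᵥ x) ^ 2 = inner ℝ ((LinearMap.adjoint T ∘ₗ T) y) y := by
    rw [LinearMap.comp_apply, LinearMap.adjoint_inner_left, real_inner_self_eq_norm_sq]
    rfl
  have h2 : euclNorm x ^ 2 = ∑ i, ((hsym.eigenvectorBasis hfin).repr y i) ^ 2 := by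
    have := (hsym.eigenvectorBasis hfin).repr.norm_map y
    rw [euclNorm, ← this, EuclideanSpace.norm_sq_eq]
    simp
  rw [mul_pow, h1, ← (hsym.eigenvectorBasis hfin).repr.inner_map_map, h2, Finset.mul_sum,
    PiLp.inner_apply]
  refine Finset.sum_le_sum fun i _ => ?_
  rw [hsym.eigenvectorBasis_apply_self_apply]
  have h3 : sigmaLast X ^ 2 ≤ hsym.eigenvalues hfin i := by
    rw [← T.sq_singularValues_fin hfin i, sigmaLast]
    refine pow_le_pow_left₀ (T.singularValues_nonneg _) (T.singularValues_antitone ?_) 2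
    have := i.2
    omega
  have h4 := mul_le_mul_of_nonneg_right h3
    (sq_nonneg ((hsym.eigenvectorBasis hfin).repr y i))
  simp only [RCLike.ofReal_real_eq_id, id_eq, RCLike.inner_apply, conj_trivial]
  nlinarith [h4]

/-! ### Rounding errors of sums and inner products -/

lemma uRound_pos : 0 < uRound := by unfold uRound; positivity

lemma uRound_lt : uRound < 1 / 128 := by unfold uRound; norm_num

/-- `(1 - u)⁻ᴺ - 1`, which bounds the relative error accumulated in `N` roundings. -/
def gammaErr (N : ℕ) : ℝ := (1 - uRound)⁻¹ ^ N - 1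

lemma one_le_inv_one_sub_uRound : 1 ≤ (1 - uRound)⁻¹ :=
  (one_le_inv₀ (by linarith [uRound_lt])).2 (by linarith [uRound_pos])

lemma gammaErr_mono {M N : ℕ} (h : M ≤ N) : gammaErr M ≤ gammaErr N :=
  sub_le_sub_right (pow_le_pow_right₀ one_le_inv_one_sub_uRound h) 1

lemma gammaErr_zero : gammaErr 0 = 0 := by simp [gammaErr]

lemma gammaErr_nonneg (N : ℕ) : 0 ≤ gammaErr N :=
  gammaErr_zero ▸ gammaErr_mono N.zero_le

/-- Equivalent to `1 + γ` being multiplicative, so that roundings accumulate with no second-order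
remainder. -/
lemma gammaErr_add (M N : ℕ) :
    gammaErr (M + N) = gammaErr M * gammaErr N + gammaErr M + gammaErr N := by
  simp only [gammaErr, pow_add]; ring

lemma uRound_le_gammaErr_one : uRound ≤ gammaErr 1 := by
  have h : 0 < 1 - uRound := by linarith [uRound_lt]
  rw [gammaErr, pow_one, le_sub_iff_add_le, ← one_div, le_div_iff₀ h]
  nlinarith [sq_nonneg uRound]

/-- By Bernoulli's inequality, `(1 - u)ᴺ ≥ 1 - Nu`. -/
lemma gammaErr_le {N : ℕ} (h : (N : ℝ) * uRound ≤ 1 / 128) :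
    gammaErr N ≤ 1.01 * (N * uRound) := by
  have h0 : 0 ≤ (N : ℝ) * uRound := mul_nonneg N.cast_nonneg uRound_pos.le
  have h1 : 1 - N * uRound ≤ (1 - uRound) ^ N := by
    have := one_add_mul_le_pow (a := -uRound) (by linarith [uRound_lt]) N
    rw [← sub_eq_add_neg] at this
    linarith
  have h2 : 0 < 1 - N * uRound := by linarith
  rw [gammaErr, inv_pow, sub_le_iff_le_add, ← one_div]
  refine (one_div_le_one_div_of_le h2 h1).trans ?_
  rw [div_le_iff₀ h2]
  nlinarith

lemma abs_mul_sub_one_le {M N : ℕ} {a b : ℝ} (ha : |a - 1| ≤ gammaErr M)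
    (hb : |b - 1| ≤ gammaErr N) : |a * b - 1| ≤ gammaErr (M + N) := by
  have h : a * b - 1 = (a - 1) * (b - 1) + (a - 1) + (b - 1) := by ring
  rw [h, gammaErr_add]
  refine (abs_add_three _ _ _).trans (add_le_add (add_le_add ?_ ha) hb)
  rw [abs_mul]
  exact mul_le_mul ha hb (abs_nonneg _) (gammaErr_nonneg M)

/-- Multiplying an approximation by a factor close to `1` accumulates the errors. -/
lemma abs_mul_sub_le {M N : ℕ} {φ x a A : ℝ} (hφ : |φ - 1| ≤ gammaErr M)
    (hx : |x - a| ≤ gammaErr N * A) (ha : |a| ≤ A) : |φ * x - a| ≤ gammaErr (M + N) * A := by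
  have h : φ * x - a = (φ - 1) * (x - a) + (x - a) + (φ - 1) * a := by ring
  have hA : 0 ≤ A := (abs_nonneg a).trans ha
  rw [h, gammaErr_add]
  have h1 : |(φ - 1) * (x - a)| ≤ gammaErr M * (gammaErr N * A) := by
    rw [abs_mul]; exact mul_le_mul hφ hx (abs_nonneg _) (gammaErr_nonneg M)
  have h2 : |(φ - 1) * a| ≤ gammaErr M * A := by
    rw [abs_mul]; exact mul_le_mul hφ ha (abs_nonneg _) (gammaErr_nonneg M)
  refine (abs_add_three _ _ _).trans ?_
  linarith

lemma one_add_pos_of_abs_le {δ : ℝ} (h : |δ| ≤ uRound) : 0 < 1 + δ := by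
  linarith [(abs_le.1 h).1, uRound_lt]

lemma abs_one_add_sub_one_le {δ : ℝ} (h : |δ| ≤ uRound) : |1 + δ - 1| ≤ gammaErr 1 := by
  rw [add_sub_cancel_left]
  exact h.trans uRound_le_gammaErr_one

/-- The worst case is `δ = -u`, where equality holds. Roundings are moved to the other side of an
equation as inverses, which is why `gammaErr` is built on `(1 - u)⁻¹` and not on `1 + u`. -/
lemma abs_inv_one_add_sub_one_le {δ : ℝ} (h : |δ| ≤ uRound) :
    |(1 + δ)⁻¹ - 1| ≤ gammaErr 1 := by
  have h0 := one_add_pos_of_abs_le h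
  have hu : 0 < 1 - uRound := by linarith [uRound_lt]
  have h1 : (1 + δ)⁻¹ - 1 = -δ / (1 + δ) := by field_simp; ring
  have h2 : gammaErr 1 = uRound / (1 - uRound) := by
    rw [gammaErr, pow_one]; field_simp; ring
  rw [h1, h2, abs_div, abs_neg, abs_of_pos h0]
  exact div_le_div₀ uRound_pos.le h hu (by linarith [(abs_le.1 h).1])

lemma FlSum.card_pos {S : Multiset ℝ} {z : ℝ} (h : FlSum S z) : 0 < S.card := by
  induction h with
  | single a => simp
  | add _ _ _ hS _ => rw [Multiset.card_add]; omega

/-- Whatever the bracketing, a term takes part in at most `card - 1` additions. -/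
lemma FlSum.abs_sub_le {S : Multiset ℝ} {z : ℝ} (h : FlSum S z) :
    |z - S.sum| ≤ gammaErr (S.card - 1) * (S.map abs).sum := by
  induction h with
  | single a => simp [gammaErr_zero]
  | @add S T x y z hS hT hz ihS ihT =>
    obtain ⟨δ, hδ, rfl⟩ := hz
    have hSc := hS.card_pos
    have hTc := hT.card_pos
    have hS0 : 0 ≤ (S.map abs).sum := (abs_nonneg _).trans (Multiset.abs_sum_le_sum_abs (s := S))
    have hT0 : 0 ≤ (T.map abs).sum := (abs_nonneg _).trans (Multiset.abs_sum_le_sum_abs (s := T))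
    have h1 : |x + y - (S.sum + T.sum)|
        ≤ gammaErr (S.card + T.card - 2) * ((S.map abs).sum + (T.map abs).sum) := by
      rw [add_sub_add_comm, mul_add]
      refine (abs_add_le _ _).trans (add_le_add (ihS.trans ?_) (ihT.trans ?_))
      · exact mul_le_mul_of_nonneg_right (gammaErr_mono (by omega)) hS0
      · exact mul_le_mul_of_nonneg_right (gammaErr_mono (by omega)) hT0
    have h2 : |S.sum + T.sum| ≤ (S.map abs).sum + (T.map abs).sum :=
      (abs_add_le _ _).trans (add_le_add Multiset.abs_sum_le_sum_abs Multiset.abs_sum_le_sum_abs)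
    have h3 := abs_mul_sub_le (abs_one_add_sub_one_le hδ) h1 h2
    rw [Multiset.sum_add, Multiset.map_add, Multiset.sum_add, Multiset.card_add, mul_comm]
    convert h3 using 3
    omega

/-- In a floating-point sum with a distinguished term `a`, the rounding errors may be attributed to
the other terms and to a factor of the result. -/
lemma FlSum.exists_factor {S' : Multiset ℝ} {t : ℝ} (h : FlSum S' t) :
    ∀ (a : ℝ) (S : Multiset ℝ), S' = a ::ₘ S → ∃ ψ : ℝ, 0 < ψ ∧ |ψ - 1| ≤ gammaErr S.card ∧
      |ψ * t - (a + S.sum)| ≤ gammaErr S.card * (S.map abs).sum := by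
  -- The case in which `a` lies in the summand `S`; the other one follows by commutativity. The
  -- factor `ψ` inverts all roundings on the path from `a` to the root, so `a` itself remains exact.
  have key : ∀ {S T : Multiset ℝ} {x y z : ℝ}, FlSum T y → Rounds (x + y) z →
      (∀ (a : ℝ) (U : Multiset ℝ), S = a ::ₘ U → ∃ ψ : ℝ, 0 < ψ ∧ |ψ - 1| ≤ gammaErr U.card ∧
        |ψ * x - (a + U.sum)| ≤ gammaErr U.card * (U.map abs).sum) →
      ∀ (a : ℝ) (U : Multiset ℝ), S = a ::ₘ U → ∃ ψ : ℝ, 0 < ψ ∧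
        |ψ - 1| ≤ gammaErr (U + T).card ∧
        |ψ * z - (a + (U + T).sum)| ≤ gammaErr (U + T).card * ((U + T).map abs).sum := by
    intro S T x y z hT hz ih a U hS
    obtain ⟨ψ, hψ, hψ1, hψ2⟩ := ih a U hS
    obtain ⟨δ, hδ, rfl⟩ := hz
    have hδ0 := one_add_pos_of_abs_le hδ
    have hTc := hT.card_pos
    have hU0 : 0 ≤ (U.map abs).sum := (abs_nonneg _).trans (Multiset.abs_sum_le_sum_abs (s := U))
    have hT0 : 0 ≤ (T.map abs).sum := (abs_nonneg _).trans (Multiset.abs_sum_le_sum_abs (s := T))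
    refine ⟨ψ * (1 + δ)⁻¹, by positivity, ?_, ?_⟩
    · refine (abs_mul_sub_one_le hψ1 (abs_inv_one_add_sub_one_le hδ)).trans (gammaErr_mono ?_)
      rw [Multiset.card_add]; omega
    · have h1 : |ψ * y - T.sum| ≤ gammaErr (U + T).card * (T.map abs).sum :=
        (abs_mul_sub_le hψ1 hT.abs_sub_le Multiset.abs_sum_le_sum_abs).trans
          (mul_le_mul_of_nonneg_right (gammaErr_mono (by rw [Multiset.card_add]; omega)) hT0)
      have h2 : |ψ * x - (a + U.sum)| ≤ gammaErr (U + T).card * (U.map abs).sum :=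
        hψ2.trans (mul_le_mul_of_nonneg_right
          (gammaErr_mono (by rw [Multiset.card_add]; omega)) hU0)
      have h3 : ψ * (1 + δ)⁻¹ * ((x + y) * (1 + δ)) - (a + (U + T).sum)
          = (ψ * x - (a + U.sum)) + (ψ * y - T.sum) := by
        rw [Multiset.sum_add]; field_simp; ring
      rw [h3, Multiset.map_add, Multiset.sum_add, mul_add]
      exact (abs_add_le _ _).trans (add_le_add h2 h1)
  induction h with
  | single b =>
    intro a S hS
    obtain rfl : S = 0 := by
      have := congrArg Multiset.card hS
      simpa using this
    obtain rfl : b = a := by simpa using hS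
    exact ⟨1, one_pos, by simp [gammaErr_zero], by simp⟩
  | @add S T x y z hS hT hz ihS ihT =>
    intro a V hV
    have ha : a ∈ S + T := hV ▸ Multiset.mem_cons_self a V
    rcases Multiset.mem_add.1 ha with ha | ha
    · obtain ⟨U, rfl⟩ := Multiset.exists_cons_of_mem ha
      rw [Multiset.cons_add, Multiset.cons_inj_right] at hV
      exact hV ▸ key hT hz ihS a U rfl
    · obtain ⟨U, rfl⟩ := Multiset.exists_cons_of_mem ha
      rw [Multiset.add_cons, Multiset.cons_inj_right, add_comm] at hV
      rw [add_comm] at hz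
      exact hV ▸ key hS hz ihT a U rfl

lemma Rounds.abs_sub_le {x y : ℝ} (h : Rounds x y) : |y - x| ≤ gammaErr 1 * |x| := by
  obtain ⟨δ, hδ, rfl⟩ := h
  rw [show x * (1 + δ) - x = δ * x by ring, abs_mul]
  exact mul_le_mul_of_nonneg_right (hδ.trans uRound_le_gammaErr_one) (abs_nonneg x)

lemma abs_sum_sub_sum_le {ι : Type*} (s : Finset ι) (p q : ι → ℝ)
    (h : ∀ k ∈ s, |q k - p k| ≤ gammaErr 1 * |p k|) :
    |∑ k ∈ s, q k - ∑ k ∈ s, p k| ≤ gammaErr 1 * ∑ k ∈ s, |p k| ∧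
      ∑ k ∈ s, |q k| ≤ (1 + gammaErr 1) * ∑ k ∈ s, |p k| := by
  constructor
  · rw [← Finset.sum_sub_distrib, Finset.mul_sum]
    exact (Finset.abs_sum_le_sum_abs _ _).trans (Finset.sum_le_sum h)
  · rw [Finset.mul_sum]
    refine Finset.sum_le_sum fun k hk => ?_
    have := abs_sub_abs_le_abs_sub (q k) (p k)
    linarith [h k hk]

theorem FlMul.abs_sub_le {l m n : ℕ} {A : Matrix (Fin l) (Fin m) ℝ} {B : Matrix (Fin m) (Fin n) ℝ}
    {C : Matrix (Fin l) (Fin n) ℝ} (h : FlMul A B C) (i : Fin l) (j : Fin n) :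
    |(C - A * B) i j| ≤ gammaErr m * (absM A * absM B) i j := by
  obtain ⟨q, hq, hC⟩ := h i j
  -- A floating-point sum is non-empty, so `m ≥ 1`: one rounding for the product and `m - 1` for the
  -- additions.
  have hm := hC.card_pos
  simp only [Multiset.card_map, Finset.card_val, Finset.card_univ, Fintype.card_fin] at hm
  have h1 := hC.abs_sub_le
  simp only [Multiset.card_map, Finset.card_val, Finset.card_univ, Fintype.card_fin,
    Multiset.map_map, Function.comp_def] at h1
  change |C i j - ∑ k, q k| ≤ gammaErr (m - 1) * ∑ k, |q k| at h1
  obtain ⟨h2, h3⟩ := abs_sum_sub_sum_le Finset.univ (fun k => A i k * B k j) q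
    fun k _ => (hq k).abs_sub_le
  rw [absM_mul_apply, Matrix.sub_apply, Matrix.mul_apply]
  obtain ⟨m, rfl⟩ : ∃ m', m = m' + 1 := ⟨m - 1, by omega⟩
  rw [gammaErr_add]
  rw [Nat.add_sub_cancel] at h1
  have h4 := abs_add_le (C i j - ∑ k, q k) (∑ k, q k - ∑ k, A i k * B k j)
  rw [sub_add_sub_cancel] at h4
  have h5 := mul_le_mul_of_nonneg_left h3 (gammaErr_nonneg m)
  linarith

lemma FlSubDot.exists_factor {n : ℕ} {a : ℝ} {i : Fin n} {x y : Fin n → ℝ} {t : ℝ}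
    (h : FlSubDot a i x y t) : ∃ ψ : ℝ, 0 < ψ ∧ |ψ - 1| ≤ gammaErr i ∧
      |ψ * t - (a - ∑ k ∈ Finset.Iio i, x k * y k)|
        ≤ gammaErr (i + 1) * ∑ k ∈ Finset.Iio i, |x k * y k| := by
  obtain ⟨q, hq, ht⟩ := h
  obtain ⟨ψ, hψ, hψ1, hψ2⟩ := ht.exists_factor _ _ rfl
  simp only [Multiset.card_map, Finset.card_val, Fin.card_Iio, Multiset.map_map,
    Function.comp_def, abs_neg] at hψ1 hψ2
  change |ψ * t - (a + ∑ k ∈ Finset.Iio i, -q k)|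
    ≤ gammaErr i * ∑ k ∈ Finset.Iio i, |q k| at hψ2
  refine ⟨ψ, hψ, hψ1, ?_⟩
  obtain ⟨h2, h3⟩ := abs_sum_sub_sum_le (Finset.Iio i) (fun k => x k * y k) q
    fun k hk => (hq k (Finset.mem_Iio.1 hk)).abs_sub_le
  rw [Finset.sum_neg_distrib] at hψ2
  have h4 := abs_sub (ψ * t - (a + -∑ k ∈ Finset.Iio i, q k))
    (∑ k ∈ Finset.Iio i, q k - ∑ k ∈ Finset.Iio i, x k * y k)
  have h5 := mul_le_mul_of_nonneg_left h3 (gammaErr_nonneg i)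
  rw [gammaErr_add]
  calc _ = |(ψ * t - (a + -∑ k ∈ Finset.Iio i, q k))
      - (∑ k ∈ Finset.Iio i, q k - ∑ k ∈ Finset.Iio i, x k * y k)| := by
        congr 1; ring
    _ ≤ _ := h4
    _ ≤ _ := by linarith

/-- A result `r`, one or two roundings away from `t`, of a floating-point evaluation of
`t = a - ∑_{k < i} x_k y_k`. -/
lemma FlSubDot.abs_sub_le {n : ℕ} {a : ℝ} {i : Fin n} {x y : Fin n → ℝ} {t r φ : ℝ} {N : ℕ}
    (h : FlSubDot a i x y t) (hN : 1 ≤ N) (hφ : |φ - 1| ≤ gammaErr N) (hr : t = φ * r) :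
    |a - ∑ k ∈ Finset.Iio i, x k * y k - r|
      ≤ gammaErr (i + N) * (∑ k ∈ Finset.Iio i, |x k * y k| + |r|) := by
  obtain ⟨ψ, -, hψ1, hψ2⟩ := h.exists_factor
  have h1 := abs_mul_sub_one_le hψ1 hφ
  have h2 : |(ψ * φ - 1) * r| ≤ gammaErr (i + N) * |r| := by
    rw [abs_mul]; exact mul_le_mul_of_nonneg_right h1 (abs_nonneg r)
  have h3 : gammaErr (i + 1) * ∑ k ∈ Finset.Iio i, |x k * y k|
      ≤ gammaErr (i + N) * ∑ k ∈ Finset.Iio i, |x k * y k| :=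
    mul_le_mul_of_nonneg_right (gammaErr_mono (by omega))
      (Finset.sum_nonneg fun k _ => abs_nonneg _)
  subst hr
  have h4 := abs_sub ((ψ * φ - 1) * r) (ψ * (φ * r) - (a - ∑ k ∈ Finset.Iio i, x k * y k))
  calc _ = |(ψ * φ - 1) * r - (ψ * (φ * r) - (a - ∑ k ∈ Finset.Iio i, x k * y k))| := by
        congr 1; ring
    _ ≤ _ := h4
    _ ≤ _ := by linarith

lemma FlSubDot.abs_sub_div_le {n : ℕ} {a : ℝ} {i : Fin n} {x y : Fin n → ℝ} {t d w : ℝ}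
    (h : FlSubDot a i x y t) (hd : d ≠ 0) (hw : Rounds (t / d) w) :
    |a - ∑ k ∈ Finset.Iio i, x k * y k - w * d|
      ≤ gammaErr (i + 1) * (∑ k ∈ Finset.Iio i, |x k * y k| + |w * d|) := by
  obtain ⟨δ, hδ, rfl⟩ := hw
  have h0 := one_add_pos_of_abs_le hδ
  exact h.abs_sub_le le_rfl (abs_inv_one_add_sub_one_le hδ) (by field_simp)

/-- The rounding of the root counts twice, because `r² = t (1 + δ)²`. -/
lemma FlSubDot.abs_sub_sqrt_le {n : ℕ} {a : ℝ} {i : Fin n} {x y : Fin n → ℝ} {t r : ℝ}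
    (h : FlSubDot a i x y t) (ht : 0 < t) (hr : Rounds (√t) r) :
    |a - ∑ k ∈ Finset.Iio i, x k * y k - r * r|
      ≤ gammaErr (i + 2) * (∑ k ∈ Finset.Iio i, |x k * y k| + |r * r|) := by
  obtain ⟨δ, hδ, rfl⟩ := hr
  have h0 := one_add_pos_of_abs_le hδ
  have h1 := abs_inv_one_add_sub_one_le hδ
  refine h.abs_sub_le one_le_two (abs_mul_sub_one_le h1 h1) ?_
  have h2 := Real.mul_self_sqrt ht.le
  field_simp
  linear_combination -h2

lemma Rounds.pos {x y : ℝ} (h : Rounds x y) (hx : 0 < x) : 0 < y := by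
  obtain ⟨δ, hδ, rfl⟩ := h
  exact mul_pos hx (one_add_pos_of_abs_le hδ)

/-! ### Backward error of the Cholesky factorization and of substitution -/

lemma sum_eq_sum_Iio_add {n : ℕ} {i : Fin n} {f : Fin n → ℝ} (h : ∀ k, i < k → f k = 0) :
    ∑ k, f k = ∑ k ∈ Finset.Iio i, f k + f i := by
  have h1 : ∑ k, f k = ∑ k ∈ insert i (Finset.Iio i), f k := by
    refine (Finset.sum_subset (Finset.subset_univ _) fun k _ hk => h k ?_).symm
    simp only [Finset.mem_insert, Finset.mem_Iio, not_or, not_lt] at hk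
    exact lt_of_le_of_ne hk.2 (Ne.symm hk.1)
  rw [h1, Finset.sum_insert (by simp), add_comm]

lemma FlCholeskyRow.diag_pos {n : ℕ} {G R : Matrix (Fin n) (Fin n) ℝ} {i : Fin n}
    (h : FlCholeskyRow G R i) : 0 < R i i := by
  obtain ⟨-, ⟨t, -, ht, hr⟩, -⟩ := h
  exact hr.pos (Real.sqrt_pos.2 ht)

/-- Stated for a single row, since a run that breaks down provides only the rows before the failure.
The largest count is `i + 2 ≤ n + 1`, on the diagonal. -/
lemma FlCholeskyRow.abs_sub_le {n : ℕ} {G R : Matrix (Fin n) (Fin n) ℝ} {i j : Fin n}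
    (h : FlCholeskyRow G R i) (hij : i ≤ j) :
    |∑ k ∈ Finset.Iio i, R k i * R k j + R i i * R i j - G i j|
      ≤ gammaErr (n + 1) * (∑ k ∈ Finset.Iio i, |R k i * R k j| + |R i i * R i j|) := by
  have hpos := h.diag_pos
  have h0 : 0 ≤ ∑ k ∈ Finset.Iio i, |R k i * R k j| + |R i i * R i j| := by positivity
  rw [abs_sub_comm, ← sub_sub]
  rcases hij.eq_or_lt with rfl | hij
  · obtain ⟨-, ⟨t, hs, ht, hr⟩, -⟩ := h
    exact (hs.abs_sub_sqrt_le ht hr).trans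
      (mul_le_mul_of_nonneg_right (gammaErr_mono (by have := i.2; omega)) h0)
  · obtain ⟨-, -, h⟩ := h
    obtain ⟨t, hs, hr⟩ := h j hij
    have := hs.abs_sub_div_le hpos.ne' hr
    rw [mul_comm (R i j)] at this
    exact this.trans (mul_le_mul_of_nonneg_right (gammaErr_mono (by have := i.2; omega)) h0)

/-- The symmetric matrix with the same upper triangle as `G`. -/
def upperSym {n : ℕ} (G : Matrix (Fin n) (Fin n) ℝ) : Matrix (Fin n) (Fin n) ℝ :=
  fun i j => G (min i j) (max i j)

lemma upperSym_comm {n : ℕ} (G : Matrix (Fin n) (Fin n) ℝ) (i j : Fin n) :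
    upperSym G i j = upperSym G j i := by
  simp only [upperSym, min_comm, max_comm]

lemma upperSym_of_le {n : ℕ} (G : Matrix (Fin n) (Fin n) ℝ) {i j : Fin n} (h : i ≤ j) :
    upperSym G i j = G i j := by
  simp only [upperSym, min_eq_left h, max_eq_right h]

lemma transpose_mul_self_comm {m n : ℕ} (A : Matrix (Fin m) (Fin n) ℝ) (i j : Fin n) :
    (Aᵀ * A) i j = (Aᵀ * A) j i := by
  simp [Matrix.mul_apply, mul_comm]

lemma absM_transpose_mul_diag {m n : ℕ} (A : Matrix (Fin m) (Fin n) ℝ) (j : Fin n) :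
    (absM Aᵀ * absM A) j j = (Aᵀ * A) j j := by
  rw [absM_mul_apply, Matrix.mul_apply]
  exact Finset.sum_congr rfl fun k _ => abs_of_nonneg (mul_self_nonneg _)

/-- The computed `G` need not be symmetric, as its two triangles may be rounded differently; the
factor approximates the symmetric matrix determined by the entries that are read. -/
theorem FlCholesky.abs_sub_le {n : ℕ} {G R : Matrix (Fin n) (Fin n) ℝ} (h : FlCholesky G R)
    (i j : Fin n) :
    |(Rᵀ * R - upperSym G) i j| ≤ gammaErr (n + 1) * (absM Rᵀ * absM R) i j := by
  wlog hij : i ≤ j generalizing i j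
  · have := this j i (le_of_not_ge hij)
    rwa [Matrix.sub_apply, transpose_mul_self_comm, upperSym_comm, absM_transpose_mul_comm] at this
  have hz : ∀ k, i < k → R k i = 0 := fun k hk => (h k).1 i hk
  have h1 := (h i).abs_sub_le hij
  rw [Matrix.sub_apply, upperSym_of_le G hij, absM_mul_apply, Matrix.mul_apply]
  simp only [Matrix.transpose_apply]
  rwa [sum_eq_sum_Iio_add (i := i) fun k hk => by rw [hz k hk, zero_mul],
    sum_eq_sum_Iio_add (i := i) fun k hk => by rw [hz k hk, zero_mul, abs_zero]]

theorem FlSolve.abs_sub_le {m n : ℕ} {X W : Matrix (Fin m) (Fin n) ℝ}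
    {Y : Matrix (Fin n) (Fin n) ℝ} (h : FlSolve X Y W) (hY : ∀ i j, j < i → Y i j = 0)
    (hd : ∀ j, Y j j ≠ 0) (i : Fin m) (j : Fin n) :
    |(W * Y - X) i j| ≤ gammaErr n * (absM W * absM Y) i j := by
  obtain ⟨t, hs, hr⟩ := h i j
  have h1 := hs.abs_sub_div_le (hd j) hr
  rw [Matrix.sub_apply, absM_mul_apply, Matrix.mul_apply,
    sum_eq_sum_Iio_add (i := j) fun k hk => by rw [hY k j hk, mul_zero],
    sum_eq_sum_Iio_add (i := j) fun k hk => by rw [hY k j hk, mul_zero, abs_zero],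
    abs_sub_comm, ← sub_sub]
  exact h1.trans (mul_le_mul_of_nonneg_right (gammaErr_mono j.2) (by positivity))

/-- A Cholesky run that breaks down yields a direction in which the matrix is not safely positive:
the part of the factor computed so far has a kernel vector. -/
theorem FlCholeskyBreaks.exists_quadForm_le {n : ℕ} {G : Matrix (Fin n) (Fin n) ℝ}
    (hb : FlCholeskyBreaks G) (hdiag : ∀ j, 0 ≤ G j j)
    (hγ1 : gammaErr (n + 1) < 1) :
    ∃ x : Fin n → ℝ, x ≠ 0 ∧ (1 - gammaErr (n + 1)) * (x ⬝ᵥ (upperSym G *ᵥ x))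
      ≤ 4 * gammaErr (n + 1) * (∑ j, G j j) * euclNorm x ^ 2 := by
  obtain ⟨R, i, t, hrow, hs, ht⟩ := hb
  set γ := gammaErr (n + 1) with hγ
  have hγ0 : 0 ≤ γ := gammaErr_nonneg _
  set P : Matrix (Fin n) (Fin n) ℝ := fun k j => if k < i then R k j else 0 with hP
  -- The zero row `i` makes `M` singular; the unit rows below it force a kernel vector to vanish
  -- beyond `i`, and the rows above make it orthogonal to the computed rows.
  set M : Matrix (Fin n) (Fin n) ℝ :=
    fun k j => if k < i then R k j else if i < k ∧ k = j then 1 else 0 with hM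
  have hdet : M.det = 0 := Matrix.det_eq_zero_of_row_eq_zero i fun j => by simp [hM]
  obtain ⟨x, hx0, hMx⟩ := Matrix.exists_mulVec_eq_zero_iff.2 hdet
  have hxi : ∀ k, i < k → x k = 0 := by
    intro k hk
    have h := congrFun hMx k
    simpa [Matrix.mulVec, dotProduct, hM, not_lt.2 hk.le, hk] using h
  have hPx : ∀ k, ∑ j, P k j * x j = 0 := by
    intro k
    by_cases hk : k < i
    · have h := congrFun hMx k
      simpa [Matrix.mulVec, dotProduct, hM, hP, hk] using h
    · simp [hP, hk]
  refine ⟨x, hx0, ?_⟩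
  -- entries of the Gram matrix of the computed rows
  have hgram : ∀ (j l : Fin n) (f : ℝ → ℝ), f 0 = 0 → j < i →
      ∑ k, f (P k j * P k l) = ∑ k ∈ Finset.Iio j, f (R k j * R k l) + f (R j j * R j l) := by
    intro j l f hf hj
    rw [sum_eq_sum_Iio_add (i := j)]
    · simp only [hP, hj, if_true]
      congr 1
      refine Finset.sum_congr rfl fun k hk => ?_
      rw [if_pos ((Finset.mem_Iio.1 hk).trans hj), if_pos ((Finset.mem_Iio.1 hk).trans hj)]
    · intro k hk
      by_cases hki : k < i
      · simp [hP, hki, (hrow k hki).1 j hk, hf]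
      · simp [hP, hki, hf]
  have hentry : ∀ j l, j < i → j ≤ l →
      |(Pᵀ * P) j l - upperSym G j l| ≤ γ * (absM Pᵀ * absM P) j l := by
    intro j l hj hjl
    have h := (hrow j hj).abs_sub_le hjl
    rw [Matrix.mul_apply, absM_mul_apply, upperSym_of_le G hjl]
    simp only [Matrix.transpose_apply]
    have e1 := hgram j l id rfl hj
    simp only [id] at e1
    rw [e1, hgram j l (fun a => |a|) abs_zero hj]
    exact h
  -- Only this one-sided bound is available at the failing pivot, from `t ≤ 0`. It suffices, because
  -- the diagonal term is weighted by `x_i² ≥ 0`.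
  have hlast : upperSym G i i - (Pᵀ * P) i i ≤ γ * (absM Pᵀ * absM P) i i := by
    obtain ⟨ψ, hψ, -, h⟩ := hs.exists_factor
    have h1 := (abs_le.1 h).1
    have h2 : ψ * t ≤ 0 := mul_nonpos_of_nonneg_of_nonpos hψ.le ht
    have hsum : ∀ f : ℝ → ℝ, f 0 = 0 →
        ∑ k, f (P k i * P k i) = ∑ k ∈ Finset.Iio i, f (R k i * R k i) := by
      intro f hf
      rw [sum_eq_sum_Iio_add (i := i)]
      · simp only [hP, lt_self_iff_false, if_false, mul_zero, hf, add_zero]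
        refine Finset.sum_congr rfl fun k hk => ?_
        simp only [if_pos (Finset.mem_Iio.1 hk)]
      · intro k hk
        simp [hP, not_lt.2 hk.le, hf]
    have e1 := hsum id rfl
    simp only [id] at e1
    rw [upperSym_of_le G le_rfl, Matrix.mul_apply, absM_mul_apply]
    simp only [Matrix.transpose_apply]
    rw [e1, hsum (fun a => |a|) abs_zero]
    have h3 : gammaErr (i + 1) * ∑ k ∈ Finset.Iio i, |R k i * R k i|
        ≤ γ * ∑ k ∈ Finset.Iio i, |R k i * R k i| :=
      mul_le_mul_of_nonneg_right (gammaErr_mono (by have := i.2; omega)) (by positivity)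
    linarith
  have hterm : ∀ j l, x j * ((upperSym G - Pᵀ * P) j l * x l)
      ≤ γ * (|x j| * ((absM Pᵀ * absM P) j l * |x l|)) := by
    intro j l
    rcases lt_or_ge i j with hj | hj
    · simp [hxi j hj]
    rcases lt_or_ge i l with hl | hl
    · simp [hxi l hl]
    rw [Matrix.sub_apply]
    have habs : |(Pᵀ * P) j l - upperSym G j l| ≤ γ * (absM Pᵀ * absM P) j l →
        x j * ((upperSym G j l - (Pᵀ * P) j l) * x l)
          ≤ γ * (|x j| * ((absM Pᵀ * absM P) j l * |x l|)) := by
      intro h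
      refine (le_abs_self _).trans ?_
      rw [abs_mul, abs_mul, abs_sub_comm]
      have := mul_le_mul_of_nonneg_left (mul_le_mul_of_nonneg_right h (abs_nonneg (x l)))
        (abs_nonneg (x j))
      linarith
    by_cases hji : j < i
    · rcases le_total j l with hjl | hjl
      · exact habs (hentry j l hji hjl)
      · refine habs ?_
        rw [transpose_mul_self_comm, upperSym_comm, absM_transpose_mul_comm]
        exact hentry l j (hjl.trans_lt hji) hjl
    · obtain rfl : j = i := le_antisymm hj (not_lt.1 hji)
      by_cases hli : l < j
      · refine habs ?_
        rw [transpose_mul_self_comm, upperSym_comm, absM_transpose_mul_comm]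
        exact hentry l j hli hli.le
      · obtain rfl : l = j := le_antisymm hl (not_lt.1 hli)
        have h1 := mul_le_mul_of_nonneg_left hlast (mul_self_nonneg (x l))
        have h2 := abs_mul_abs_self (x l)
        calc _ = x l * x l * (upperSym G l l - (Pᵀ * P) l l) := by ring
          _ ≤ _ := h1
          _ = γ * ((|x l| * |x l|) * (absM Pᵀ * absM P) l l) := by rw [h2]; ring
          _ = _ := by ring
  -- the kernel vector turns the last column into a combination of the others
  set P₀ : Matrix (Fin n) (Fin n) ℝ := fun k j => if j < i then P k j else 0 with hP₀
  set y : Fin n → ℝ := fun j => |x j| with hy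
  have hynorm : euclNorm y ^ 2 = euclNorm x ^ 2 := by simp [euclNorm_sq, hy]
  have hquad : x ⬝ᵥ (upperSym G *ᵥ x) ≤ γ * euclNorm (absM P *ᵥ y) ^ 2 := by
    have h0 : x ⬝ᵥ ((Pᵀ * P) *ᵥ x) = 0 := by
      rw [dotProduct_gram, euclNorm_sq]
      exact Finset.sum_eq_zero fun k _ => by
        rw [show (P *ᵥ x) k = 0 from hPx k]; simp
    rw [← sub_zero (x ⬝ᵥ _), ← h0, ← dotProduct_sub, ← Matrix.sub_mulVec, ← dotProduct_gram]
    simp only [dotProduct, Matrix.mulVec, Finset.mul_sum]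
    exact Finset.sum_le_sum fun j _ => Finset.sum_le_sum fun l _ => hterm j l
  -- Column `i` of `P` is not bounded above by `G`. Since `Px = 0`, its contribution is at most that
  -- of the earlier columns, which doubles the norm and gives the factor `4`.
  have hcol : euclNorm (absM P *ᵥ y) ^ 2 ≤ 4 * euclNorm (absM P₀ *ᵥ y) ^ 2 := by
    rw [euclNorm_sq, euclNorm_sq, Finset.mul_sum]
    refine Finset.sum_le_sum fun k _ => ?_
    have hsplit : ∀ f : Fin n → ℝ, (∀ j, x j = 0 → f j = 0) →
        ∑ j, f j = ∑ j ∈ Finset.Iio i, f j + f i := fun f hf =>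
      sum_eq_sum_Iio_add fun j hj => hf j (hxi j hj)
    have e0 : (absM P₀ *ᵥ y) k = ∑ j ∈ Finset.Iio i, |P k j| * |x j| := by
      change ∑ j, |P₀ k j| * |x j| = _
      rw [hsplit _ fun j hj => by simp [hj]]
      simp only [hP₀, lt_self_iff_false, if_false, abs_zero, zero_mul, add_zero]
      refine Finset.sum_congr rfl fun j hj => ?_
      rw [if_pos (Finset.mem_Iio.1 hj)]
    have e1 : (absM P *ᵥ y) k = ∑ j ∈ Finset.Iio i, |P k j| * |x j| + |P k i| * |x i| := by
      change ∑ j, |P k j| * |x j| = _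
      rw [hsplit _ fun j hj => by simp [hj]]
    have e2 : |P k i| * |x i| ≤ ∑ j ∈ Finset.Iio i, |P k j| * |x j| := by
      have h := hPx k
      rw [hsplit _ fun j hj => by simp [hj]] at h
      rw [← abs_mul, eq_neg_of_add_eq_zero_right h, abs_neg]
      simpa only [abs_mul] using Finset.abs_sum_le_sum_abs (fun j => P k j * x j) (Finset.Iio i)
    have e3 : 0 ≤ |P k i| * |x i| := by positivity
    rw [e0, e1]
    nlinarith
  have hfrob : (1 - γ) * frobNorm P₀ ^ 2 ≤ ∑ j, G j j := by
    rw [sq_frobNorm_eq_trace, Finset.mul_sum]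
    refine Finset.sum_le_sum fun j _ => ?_
    by_cases hj : j < i
    · have h := (abs_le.1 (hentry j j hj le_rfl)).2
      have e1 : (P₀ᵀ * P₀) j j = (Pᵀ * P) j j := by
        rw [Matrix.mul_apply, Matrix.mul_apply]
        refine Finset.sum_congr rfl fun k _ => ?_
        change P₀ k j * P₀ k j = P k j * P k j
        simp only [hP₀, hj, if_true]
      rw [upperSym_of_le G le_rfl, absM_transpose_mul_diag] at h
      rw [e1]
      linarith
    · have e1 : (P₀ᵀ * P₀) j j = 0 := by
        rw [Matrix.mul_apply]
        simp only [hP₀, hj, if_false, mul_zero, Finset.sum_const_zero]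
      rw [e1, mul_zero]
      exact hdiag j
  have hP₀y : euclNorm (absM P₀ *ᵥ y) ^ 2 ≤ frobNorm P₀ ^ 2 * euclNorm x ^ 2 := by
    rw [← hynorm, ← frobNorm_absM P₀, ← mul_pow]
    exact pow_le_pow_left₀ (euclNorm_nonneg _) (euclNorm_mulVec_le_frobNorm _ _) 2
  have h1γ : 0 < 1 - γ := by linarith
  calc (1 - γ) * (x ⬝ᵥ (upperSym G *ᵥ x))
      ≤ (1 - γ) * (γ * (4 * (frobNorm P₀ ^ 2 * euclNorm x ^ 2))) := by
        refine mul_le_mul_of_nonneg_left (hquad.trans ?_) h1γ.le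
        refine mul_le_mul_of_nonneg_left (hcol.trans ?_) hγ0
        linarith
    _ = (1 - γ) * frobNorm P₀ ^ 2 * (4 * γ * euclNorm x ^ 2) := by ring
    _ ≤ (∑ j, G j j) * (4 * γ * euclNorm x ^ 2) :=
        mul_le_mul_of_nonneg_right hfrob (by positivity)
    _ = _ := by ring

/-! ### Cholesky factorization of a computed Gram matrix -/

section Gram

variable {p n : ℕ} {A : Matrix (Fin p) (Fin n) ℝ} {G Y : Matrix (Fin n) (Fin n) ℝ}

lemma FlMul.abs_upperSym_sub_le (h : FlMul Aᵀ A G) (i j : Fin n) :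
    |(upperSym G - Aᵀ * A) i j| ≤ gammaErr p * (absM Aᵀ * absM A) i j := by
  wlog hij : i ≤ j generalizing i j
  · have := this j i (le_of_not_ge hij)
    rwa [Matrix.sub_apply, transpose_mul_self_comm, upperSym_comm, absM_transpose_mul_comm] at this
  rw [Matrix.sub_apply, upperSym_of_le G hij]
  exact h.abs_sub_le i j

lemma FlMul.abs_diag_sub_le (h : FlMul Aᵀ A G) (j : Fin n) :
    |G j j - (Aᵀ * A) j j| ≤ gammaErr p * (Aᵀ * A) j j := by
  have := h.abs_sub_le j j
  rwa [absM_transpose_mul_diag] at this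

lemma transpose_mul_self_diag_nonneg (A : Matrix (Fin p) (Fin n) ℝ) (j : Fin n) :
    0 ≤ (Aᵀ * A) j j := by
  rw [← absM_transpose_mul_diag]
  exact absM_mul_nonneg _ _ _ _

lemma FlMul.trace_le (h : FlMul Aᵀ A G) :
    ∑ j, G j j ≤ (1 + gammaErr p) * frobNorm A ^ 2 := by
  rw [sq_frobNorm_eq_trace, Finset.mul_sum]
  exact Finset.sum_le_sum fun j _ => by linarith [(abs_le.1 (h.abs_diag_sub_le j)).2]

lemma FlMul.diag_nonneg (h : FlMul Aᵀ A G) (hγ : gammaErr p ≤ 1) (j : Fin n) : 0 ≤ G j j := by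
  have h1 := (abs_le.1 (h.abs_diag_sub_le j)).1
  have h2 := transpose_mul_self_diag_nonneg A j
  nlinarith

lemma FlMul.frobNorm_upperSym_sub_le (h : FlMul Aᵀ A G) :
    frobNorm (upperSym G - Aᵀ * A) ≤ gammaErr p * frobNorm A ^ 2 := by
  have := frobNorm_le_of_abs_le_mul (gammaErr_nonneg p) h.abs_upperSym_sub_le
  rwa [frobNorm_transpose, ← sq] at this

/-- The Cholesky factorization of a computed Gram matrix `AᵀA` cannot break down if
`σ_n(A)²` exceeds the rounding errors. -/
theorem FlMul.not_flCholeskyBreaks {lam : ℝ} (hp : (p : ℝ) * uRound ≤ 1 / 128)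
    (hn : ((n : ℝ) + 1) * uRound ≤ 1 / 128) (h : FlMul Aᵀ A G)
    (hlow : ∀ x, lam * euclNorm x ^ 2 ≤ euclNorm (A *ᵥ x) ^ 2)
    (hlam : 5 * (((p : ℝ) + n + 1) * uRound) * frobNorm A ^ 2 < lam) : ¬ FlCholeskyBreaks G := by
  intro hb
  have hγp := gammaErr_le hp
  have hγn : gammaErr (n + 1) ≤ 1.01 * (((n : ℝ) + 1) * uRound) := by
    have := gammaErr_le (N := n + 1) (by push_cast; exact hn)
    push_cast at this; exact this
  have hγp0 := gammaErr_nonneg p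
  have hγn0 := gammaErr_nonneg (n + 1)
  obtain ⟨x, hx0, hx⟩ := hb.exists_quadForm_le (h.diag_nonneg (by linarith)) (by linarith)
  have hN : 0 < euclNorm x ^ 2 := pow_pos (euclNorm_pos hx0) 2
  have h1 := (abs_le.1 (abs_quadForm_le (upperSym G - Aᵀ * A) x)).1
  rw [Matrix.sub_mulVec, dotProduct_sub, dotProduct_gram] at h1
  have h2 := mul_le_mul_of_nonneg_right h.frobNorm_upperSym_sub_le hN.le
  set F := frobNorm A ^ 2 with hF
  have hF0 : 0 ≤ F := sq_nonneg _
  have h3 : (lam - gammaErr p * F) * euclNorm x ^ 2 ≤ x ⬝ᵥ (upperSym G *ᵥ x) := by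
    linarith [hlow x]
  have h4 : 0 ≤ 4 * gammaErr (n + 1) * euclNorm x ^ 2 := by positivity
  have h5 := mul_le_mul_of_nonneg_left h.trace_le h4
  -- With `γ ≤ 1.01 Nu ≤ 0.01` this gives `lam ≤ 1.01 pu F + 4.13 (n + 1)u F`, against the factor
  -- `5` in `hlam`.
  have h6 : (1 - gammaErr (n + 1)) * (lam - gammaErr p * F)
      ≤ 4 * gammaErr (n + 1) * ((1 + gammaErr p) * F) := by
    refine le_of_mul_le_mul_right ?_ hN
    have := mul_le_mul_of_nonneg_left h3 (show 0 ≤ 1 - gammaErr (n + 1) by linarith)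
    linarith
  have hpF : gammaErr p * F ≤ 1.01 * (p * uRound) * F := mul_le_mul_of_nonneg_right hγp hF0
  have hnF : gammaErr (n + 1) * F ≤ 1.01 * (((n : ℝ) + 1) * uRound) * F :=
    mul_le_mul_of_nonneg_right hγn hF0
  have hnF0 : 0 ≤ gammaErr (n + 1) * F := mul_nonneg hγn0 hF0
  have hpF0 : 0 ≤ (p : ℝ) * uRound * F :=
    mul_nonneg (mul_nonneg p.cast_nonneg uRound_pos.le) hF0
  have h7 : gammaErr (n + 1) * F * (1 + gammaErr p) ≤ gammaErr (n + 1) * F * 1.01 :=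
    mul_le_mul_of_nonneg_left (by linarith) hnF0
  have h8 : 0.99 * (lam - gammaErr p * F) ≤ (1 - gammaErr (n + 1)) * (lam - gammaErr p * F) := by
    refine mul_le_mul_of_nonneg_right (by linarith) ?_
    nlinarith
  have hnF1 : 0 ≤ ((n : ℝ) + 1) * uRound * F :=
    mul_nonneg (mul_nonneg (by positivity) uRound_pos.le) hF0
  have h9 : 5 * (((p : ℝ) + n + 1) * uRound) * F
      = 5 * (p * uRound * F) + 5 * (((n : ℝ) + 1) * uRound * F) := by ring
  linarith

/-- Take traces: on the diagonal the Cholesky error is relative to the diagonal of `YᵀY` itself and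
can be absorbed on the left. -/
lemma FlMul.sq_frobNorm_flCholesky_le (hp : (p : ℝ) * uRound ≤ 1 / 128)
    (hn : ((n : ℝ) + 1) * uRound ≤ 1 / 128) (h : FlMul Aᵀ A G) (hY : FlCholesky G Y) :
    frobNorm Y ^ 2 ≤ 1.02 * frobNorm A ^ 2 := by
  have hγp := gammaErr_le hp
  have hγn : gammaErr (n + 1) ≤ 1.01 * (((n : ℝ) + 1) * uRound) := by
    have := gammaErr_le (N := n + 1) (by push_cast; exact hn)
    push_cast at this; exact this
  have h1 : frobNorm Y ^ 2 ≤ ∑ j, G j j + gammaErr (n + 1) * frobNorm Y ^ 2 := by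
    rw [sq_frobNorm_eq_trace, Finset.mul_sum, ← Finset.sum_add_distrib]
    refine Finset.sum_le_sum fun j _ => ?_
    have := (abs_le.1 (hY.abs_sub_le j j)).2
    rw [absM_transpose_mul_diag, Matrix.sub_apply, upperSym_of_le G le_rfl] at this
    linarith
  have h2 := h.trace_le
  have hY0 := sq_nonneg (frobNorm Y)
  have hA0 := sq_nonneg (frobNorm A)
  have h3 : gammaErr (n + 1) * frobNorm Y ^ 2 ≤ 1.01 / 128 * frobNorm Y ^ 2 :=
    mul_le_mul_of_nonneg_right (by linarith) hY0
  have h4 : gammaErr p * frobNorm A ^ 2 ≤ 1.01 / 128 * frobNorm A ^ 2 :=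
    mul_le_mul_of_nonneg_right (by linarith) hA0
  linarith

lemma FlMul.frobNorm_flCholesky_le (hp : (p : ℝ) * uRound ≤ 1 / 128)
    (hn : ((n : ℝ) + 1) * uRound ≤ 1 / 128) (h : FlMul Aᵀ A G) (hY : FlCholesky G Y) :
    frobNorm Y ≤ 1.01 * frobNorm A := by
  refine abs_le_of_sq_le_sq' ?_ (mul_nonneg (by norm_num) (frobNorm_nonneg A)) |>.2
  have := h.sq_frobNorm_flCholesky_le hp hn hY
  rw [mul_pow]
  nlinarith [sq_nonneg (frobNorm A)]

theorem FlMul.frobNorm_flCholesky_gram_sub_le (hp : (p : ℝ) * uRound ≤ 1 / 128)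
    (hn : ((n : ℝ) + 1) * uRound ≤ 1 / 128) (h : FlMul Aᵀ A G) (hY : FlCholesky G Y) :
    frobNorm (Yᵀ * Y - Aᵀ * A) ≤ 1.04 * (((p : ℝ) + n + 1) * uRound) * frobNorm A ^ 2 := by
  have hγp := gammaErr_le hp
  have hγn : gammaErr (n + 1) ≤ 1.01 * (((n : ℝ) + 1) * uRound) := by
    have := gammaErr_le (N := n + 1) (by push_cast; exact hn)
    push_cast at this; exact this
  have h1 := frobNorm_le_of_abs_le_mul (gammaErr_nonneg (n + 1)) hY.abs_sub_le
  rw [frobNorm_transpose, ← sq] at h1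
  have h2 := h.frobNorm_upperSym_sub_le
  have h3 := frobNorm_add_le (Yᵀ * Y - upperSym G) (upperSym G - Aᵀ * A)
  rw [sub_add_sub_cancel] at h3
  have h4 := h.sq_frobNorm_flCholesky_le hp hn hY
  have hA0 := sq_nonneg (frobNorm A)
  have h5 : gammaErr (n + 1) * frobNorm Y ^ 2
      ≤ 1.01 * (((n : ℝ) + 1) * uRound) * (1.02 * frobNorm A ^ 2) :=
    mul_le_mul hγn h4 (sq_nonneg _) ((gammaErr_nonneg _).trans hγn)
  have h6 := mul_le_mul_of_nonneg_right hγp hA0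
  have h7 : 0 ≤ (p : ℝ) * uRound * frobNorm A ^ 2 :=
    mul_nonneg (mul_nonneg p.cast_nonneg uRound_pos.le) hA0
  have h8 : 0 ≤ ((n : ℝ) + 1) * uRound * frobNorm A ^ 2 :=
    mul_nonneg (mul_nonneg (by positivity) uRound_pos.le) hA0
  nlinarith

end Gram

lemma FlSolve.frobNorm_sub_le {m n : ℕ} {X W : Matrix (Fin m) (Fin n) ℝ}
    {G Y : Matrix (Fin n) (Fin n) ℝ} (hn : (n : ℝ) * uRound ≤ 1 / 128)
    (h : FlSolve X Y W) (hY : FlCholesky G Y) :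
    frobNorm (W * Y - X) ≤ 1.01 * (n * uRound) * (frobNorm W * frobNorm Y) := by
  refine (frobNorm_le_of_abs_le_mul (gammaErr_nonneg n)
    (h.abs_sub_le (fun i j hij => (hY i).1 j hij) fun j => (hY j).diag_pos.ne')).trans (mul_le_mul_of_nonneg_right (gammaErr_le hn) ?_)
  exact mul_nonneg (frobNorm_nonneg _) (frobNorm_nonneg _)

lemma FlMul.frobNorm_sub_le {l m n : ℕ} {A : Matrix (Fin l) (Fin m) ℝ}
    {B : Matrix (Fin m) (Fin n) ℝ} {C : Matrix (Fin l) (Fin n) ℝ}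
    (hm : (m : ℝ) * uRound ≤ 1 / 128) (h : FlMul A B C) :
    frobNorm (C - A * B) ≤ 1.01 * (m * uRound) * (frobNorm A * frobNorm B) :=
  (frobNorm_le_of_abs_le_mul (gammaErr_nonneg m) h.abs_sub_le).trans
    (mul_le_mul_of_nonneg_right (gammaErr_le hm)
      (mul_nonneg (frobNorm_nonneg _) (frobNorm_nonneg _)))

lemma FlCholesky.isUnit_det {n : ℕ} {G Y : Matrix (Fin n) (Fin n) ℝ} (hY : FlCholesky G Y) :
    IsUnit Y.det := by
  rw [Matrix.det_of_isUpperTriangular (fun i j hij => (hY i).1 j hij)]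
  exact (Finset.prod_pos fun j _ => (hY j).diag_pos).ne'.isUnit

/-! ### CholeskyQR of a well-conditioned matrix -/

lemma le_of_sq_le_sq_of_nonneg {a b : ℝ} (hb : 0 ≤ b) (h : a ^ 2 ≤ b ^ 2) : a ≤ b :=
  (abs_le_of_sq_le_sq' h hb).2

lemma norm2_inv_le {n : ℕ} {Z : Matrix (Fin n) (Fin n) ℝ} {c : ℝ} (hc : 0 < c)
    (hZ : IsUnit Z.det) (h : ∀ x, c * euclNorm x ≤ euclNorm (Z *ᵥ x)) : norm2 Z⁻¹ ≤ c⁻¹ := by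
  refine norm2_le (inv_nonneg.2 hc.le) fun x => ?_
  have h1 := h (Z⁻¹ *ᵥ x)
  rw [Matrix.mulVec_mulVec, Matrix.mul_nonsing_inv _ hZ, Matrix.one_mulVec] at h1
  rwa [inv_mul_eq_div, le_div_iff₀ hc, mul_comm]

/-- Here the form of `roundTerm` arises: it equals `n (m + n + 1) u`, the factor `n` coming from
`‖W‖_F² ≤ n ‖W‖₂²`. -/
lemma gram_error_le {m n : ℕ} (W : Matrix (Fin m) (Fin n) ℝ) :
    ((m : ℝ) + n + 1) * uRound * frobNorm W ^ 2 ≤ roundTerm m n * norm2 W ^ 2 := by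
  have h := pow_le_pow_left₀ (frobNorm_nonneg W) (frobNorm_le_sqrt_cols W) 2
  rw [mul_pow, Real.sq_sqrt n.cast_nonneg] at h
  have h1 : 0 ≤ ((m : ℝ) + n + 1) * uRound := mul_nonneg (by positivity) uRound_pos.le
  refine (mul_le_mul_of_nonneg_left h h1).trans (le_of_eq ?_)
  rw [roundTerm]; ring

lemma roundTerm_nonneg (m n : ℕ) : 0 ≤ roundTerm m n := by
  have := uRound_pos
  unfold roundTerm; positivity

section CholQR

variable {m n : ℕ} {W Q : Matrix (Fin m) (Fin n) ℝ} {C Z : Matrix (Fin n) (Fin n) ℝ} {b τ : ℝ}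

lemma roundTerm_mul_sq_norm2_le (hN : norm2 W ≤ b * τ) (hb : 64 * (b ^ 2 * roundTerm m n) ≤ 1) :
    roundTerm m n * norm2 W ^ 2 ≤ b ^ 2 * roundTerm m n * τ ^ 2 ∧
      roundTerm m n * norm2 W ^ 2 ≤ τ ^ 2 / 64 := by
  have h1 := mul_le_mul_of_nonneg_left (pow_le_pow_left₀ (norm2_nonneg W) hN 2)
    (roundTerm_nonneg m n)
  have h2 := mul_le_mul_of_nonneg_right hb (sq_nonneg τ)
  constructor <;> linarith

theorem FlMul.not_flCholeskyBreaks_of_norm2_le (hm : (m : ℝ) * uRound ≤ 1 / 128)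
    (hn : ((n : ℝ) + 1) * uRound ≤ 1 / 128) (hτ : 0 < τ) (hN : norm2 W ≤ b * τ)
    (hlow : ∀ x, τ * euclNorm x ≤ euclNorm (W *ᵥ x))
    (hb : 64 * (b ^ 2 * roundTerm m n) ≤ 1) (hC : FlMul Wᵀ W C) : ¬ FlCholeskyBreaks C := by
  have h1 := (roundTerm_mul_sq_norm2_le hN hb).2
  have h2 := gram_error_le W
  refine hC.not_flCholeskyBreaks hm hn (lam := τ ^ 2) (fun x => ?_) ?_
  · rw [← mul_pow]
    exact pow_le_pow_left₀ (mul_nonneg hτ.le (euclNorm_nonneg x)) (hlow x) 2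
  · have : 0 < τ ^ 2 := by positivity
    linarith

/-- The loss of orthogonality in one step of CholeskyQR. -/
theorem FlCholeskyQR.frobNorm_gram_sub_one_le (hm : (m : ℝ) * uRound ≤ 1 / 128)
    (hn : ((n : ℝ) + 1) * uRound ≤ 1 / 128) (hrt : roundTerm m n ≤ 1 / 32) (hτ : 0 < τ)
    (hN : norm2 W ≤ b * τ) (hlow : ∀ x, τ * euclNorm x ≤ euclNorm (W *ᵥ x))
    (hb : 64 * (b ^ 2 * roundTerm m n) ≤ 1) (hC : FlMul Wᵀ W C) (hZ : FlCholesky C Z)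
    (hQ : FlSolve W Z Q) : frobNorm (Qᵀ * Q - 1) ≤ 5 * b ^ 2 * roundTerm m n := by
  obtain ⟨hS1, hS2⟩ := roundTerm_mul_sq_norm2_le hN hb
  have hrt0 := roundTerm_nonneg m n
  set N := norm2 W with hNdef
  set r := roundTerm m n with hr
  set q := norm2 Q with hq
  have hN0 : 0 ≤ N := norm2_nonneg W
  have hq0 : 0 ≤ q := norm2_nonneg Q
  have hu := uRound_pos
  have hn' : (n : ℝ) * uRound ≤ 1 / 128 := by linarith
  -- the error of the Cholesky factorization
  set e := frobNorm (Zᵀ * Z - Wᵀ * W) with he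
  have he1 : e ≤ 1.04 * (r * N ^ 2) := by
    have h1 := hC.frobNorm_flCholesky_gram_sub_le hm hn hZ
    have h2 := gram_error_le W
    linarith
  have hZlow : ∀ x, 0.99 * τ * euclNorm x ≤ euclNorm (Z *ᵥ x) := by
    intro x
    refine le_of_sq_le_sq_of_nonneg (euclNorm_nonneg _) ?_
    have h1 := (abs_le.1 (abs_sq_euclNorm_sub_le Z W x)).1
    have h2 := pow_le_pow_left₀ (mul_nonneg hτ.le (euclNorm_nonneg x)) (hlow x) 2
    have h3 : e * euclNorm x ^ 2 ≤ 1.04 * (τ ^ 2 / 64) * euclNorm x ^ 2 :=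
      mul_le_mul_of_nonneg_right (by linarith) (sq_nonneg _)
    have h4 : 0 ≤ τ ^ 2 * euclNorm x ^ 2 := by positivity
    rw [mul_pow] at h2 ⊢
    linarith
  have hWZ : ∀ x, euclNorm (W *ᵥ x) ≤ 1.009 * euclNorm (Z *ᵥ x) := by
    intro x
    refine le_of_sq_le_sq_of_nonneg (mul_nonneg (by norm_num) (euclNorm_nonneg _)) ?_
    have h1 := (abs_le.1 (abs_sq_euclNorm_sub_le Z W x)).1
    have h2 := pow_le_pow_left₀ (by have := euclNorm_nonneg x; positivity) (hZlow x) 2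
    have h3 : e * euclNorm x ^ 2 ≤ 1.04 * (τ ^ 2 / 64) * euclNorm x ^ 2 :=
      mul_le_mul_of_nonneg_right (by linarith) (sq_nonneg _)
    have h4 : 0 ≤ euclNorm (Z *ᵥ x) ^ 2 := sq_nonneg _
    rw [mul_pow, mul_pow] at h2
    rw [mul_pow]
    linarith
  have hdet := hZ.isUnit_det
  set V := Z⁻¹ with hV
  have hZV : Z * V = 1 := Matrix.mul_nonsing_inv _ hdet
  have hVn : norm2 V ≤ (0.99 * τ)⁻¹ := norm2_inv_le (by positivity) hdet hZlow
  -- the error of the substitution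
  set D := Q * Z - W with hD
  set d := frobNorm D with hd
  have hd0 : 0 ≤ d := frobNorm_nonneg D
  have hd1 : d ≤ 1.0201 * (r * N) * q := by
    have h1 := hQ.frobNorm_sub_le hn' hZ
    have h2 := frobNorm_le_sqrt_cols Q
    have h3 := hC.frobNorm_flCholesky_le hm hn hZ
    have h4 := frobNorm_le_sqrt_cols W
    have h5 : frobNorm Q * frobNorm Z ≤ (√n * q) * (1.01 * (√n * N)) :=
      mul_le_mul h2 (by linarith) (frobNorm_nonneg _) (by positivity)
    have h6 : (√n * q) * (1.01 * (√n * N)) = 1.01 * (n * (q * N)) := by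
      have := Real.mul_self_sqrt (n.cast_nonneg (α := ℝ))
      linear_combination 1.01 * q * N * this
    have h7 : 0 ≤ (n : ℝ) * uRound := by positivity
    have h8 : n * uRound * n ≤ r := by
      have : 0 ≤ (m : ℝ) * n * uRound + n * uRound := by positivity
      rw [hr, roundTerm]; linarith
    have h9 := mul_le_mul_of_nonneg_left h5 h7
    rw [h6] at h9
    have h10 := mul_le_mul_of_nonneg_right h8 (mul_nonneg hq0 hN0)
    linarith
  -- Geometric mean of `r ≤ 1/32` and `r N² ≤ τ²/64`; note `45² ≤ 32 · 64`.
  have hrN : r * N ≤ τ / 45 := by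
    refine le_of_sq_le_sq_of_nonneg (by positivity) ?_
    have h1 : r * (r * N ^ 2) ≤ 1 / 32 * (τ ^ 2 / 64) :=
      mul_le_mul hrt hS2 (by positivity) (by norm_num)
    have h2 : 0 ≤ τ ^ 2 := sq_nonneg _
    have h3 : (r * N) ^ 2 = r * (r * N ^ 2) := by ring
    rw [h3]
    linarith
  -- The substitution error `d` involves `q` itself; the resulting inequality `q ≤ 1.009 + 0.023 q`
  -- is solved for `q`.
  have hq1 : q ≤ 1.04 := by
    have h1 : q ≤ 1.009 + d * (0.99 * τ)⁻¹ := by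
      refine norm2_le (by positivity) fun x => ?_
      have hx : Z *ᵥ (V *ᵥ x) = x := by rw [Matrix.mulVec_mulVec, hZV, Matrix.one_mulVec]
      have h2 : Q *ᵥ x = W *ᵥ (V *ᵥ x) + D *ᵥ (V *ᵥ x) := by
        rw [← Matrix.add_mulVec, hD, add_sub_cancel, ← Matrix.mulVec_mulVec, hx]
      have h3 := hWZ (V *ᵥ x)
      rw [hx] at h3
      have h4 := euclNorm_mulVec_le_frobNorm D (V *ᵥ x)
      have h5 := (euclNorm_mulVec_le V x).trans
        (mul_le_mul_of_nonneg_right hVn (euclNorm_nonneg x))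
      have h6 := mul_le_mul_of_nonneg_left h5 hd0
      rw [h2]
      refine (euclNorm_add_le _ _).trans ?_
      linarith
    have h2 : d * (0.99 * τ)⁻¹ ≤ 0.023 * q := by
      rw [← div_eq_mul_inv, div_le_iff₀ (by positivity)]
      have h3 := mul_le_mul_of_nonneg_right hrN hq0
      have h4 : 0 ≤ τ * q := by positivity
      linarith
    linarith
  have hd2 : d ≤ 1.061 * (r * N) := by
    have := mul_le_mul_of_nonneg_left hq1 (show 0 ≤ r * N by positivity)
    have : 0 ≤ r * N := by positivity
    linarith
  -- assembling the bound
  have hQV : Qᵀ * Q - 1 = Vᵀ * (Wᵀ * D + Dᵀ * W + Dᵀ * D - (Zᵀ * Z - Wᵀ * W)) * V := by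
    have hQ1 : Q = (W + D) * V := by
      rw [hD, add_sub_cancel, Matrix.mul_assoc, hZV, Matrix.mul_one]
    have h1 : (1 : Matrix (Fin n) (Fin n) ℝ) = Vᵀ * (Zᵀ * Z) * V := by
      rw [← Matrix.mul_assoc, ← Matrix.transpose_mul, hZV, Matrix.mul_assoc, hZV]; simp
    have h2 : Qᵀ * Q = Vᵀ * ((W + D)ᵀ * (W + D)) * V := by
      conv_lhs => rw [hQ1]
      rw [Matrix.transpose_mul]
      simp only [Matrix.mul_assoc]
    rw [h1, h2, ← Matrix.sub_mul, ← Matrix.mul_sub]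
    congr 2
    rw [Matrix.transpose_add, Matrix.add_mul, Matrix.mul_add, Matrix.mul_add]
    abel
  -- `2 · 1.061` from the two mixed terms, `1.061²/32` from `DᵀD` and `1.04` from the Cholesky
  -- error.
  have hM : frobNorm (Wᵀ * D + Dᵀ * W + Dᵀ * D - (Zᵀ * Z - Wᵀ * W)) ≤ 3.2 * (r * N ^ 2) := by
    have h1 := frobNorm_sub_le (Wᵀ * D + Dᵀ * W + Dᵀ * D) (Zᵀ * Z - Wᵀ * W)
    have h2 := frobNorm_add_le (Wᵀ * D + Dᵀ * W) (Dᵀ * D)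
    have h3 := frobNorm_add_le (Wᵀ * D) (Dᵀ * W)
    have h4 := frobNorm_mul_le_norm2_left Wᵀ D
    have h5 := frobNorm_mul_le_norm2_right Dᵀ W
    have h6 := frobNorm_mul_le Dᵀ D
    rw [norm2_transpose] at h4
    rw [frobNorm_transpose] at h5 h6
    have h7 : N * d ≤ N * (1.061 * (r * N)) := mul_le_mul_of_nonneg_left hd2 hN0
    have h8 : d * d ≤ 1.061 * (r * N) * (1.061 * (r * N)) :=
      mul_le_mul hd2 hd2 hd0 (by positivity)
    have h9 : r * (r * N ^ 2) ≤ 1 / 32 * (r * N ^ 2) :=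
      mul_le_mul_of_nonneg_right hrt (by positivity)
    have h10 : 0 ≤ r * N ^ 2 := by positivity
    linarith
  have h1 := frobNorm_mul_le_norm2_right (Vᵀ * (Wᵀ * D + Dᵀ * W + Dᵀ * D - (Zᵀ * Z - Wᵀ * W))) V
  have h2 := frobNorm_mul_le_norm2_left Vᵀ (Wᵀ * D + Dᵀ * W + Dᵀ * D - (Zᵀ * Z - Wᵀ * W))
  rw [norm2_transpose] at h2
  rw [hQV]
  have hV0 := norm2_nonneg V
  calc _ ≤ _ := h1
    _ ≤ (0.99 * τ)⁻¹ * (3.2 * (r * N ^ 2)) * (0.99 * τ)⁻¹ := by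
        refine mul_le_mul (h2.trans (mul_le_mul hVn hM (frobNorm_nonneg _) ?_)) hVn hV0 ?_ <;>
          positivity
    _ ≤ 5 * b ^ 2 * r := by
        have h3 : (0.99 * τ)⁻¹ * (3.2 * (r * N ^ 2)) * (0.99 * τ)⁻¹
            = 3.2 * (r * N ^ 2) / (0.99 * τ) ^ 2 := by
          field_simp
        rw [h3, div_le_iff₀ (by positivity)]
        have : 0 ≤ b ^ 2 * r * τ ^ 2 := by positivity
        nlinarith

lemma norm2_le_of_gram {h : ℝ} (hQ : frobNorm (Qᵀ * Q - 1) ≤ h) : norm2 Q ≤ √(1 + h) := by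
  have h0 : 0 ≤ h := (frobNorm_nonneg _).trans hQ
  refine norm2_le (Real.sqrt_nonneg _) fun x => ?_
  refine le_of_sq_le_sq_of_nonneg (mul_nonneg (Real.sqrt_nonneg _) (euclNorm_nonneg _)) ?_
  have h1 := (abs_le.1 (abs_sq_euclNorm_sub_le Q (1 : Matrix (Fin n) (Fin n) ℝ) x)).2
  rw [Matrix.transpose_one, Matrix.one_mul, Matrix.one_mulVec] at h1
  rw [mul_pow, Real.sq_sqrt (by linarith)]
  have h2 := mul_le_mul_of_nonneg_right hQ (sq_nonneg (euclNorm x))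
  linarith

end CholQR

/-! ### The preconditioning step -/

/-- The quantities controlling the preconditioning step: `α ‖Xx‖ ≤ ‖Ω X x‖ ≤ β ‖Xx‖`, a lower bound
`σ` of the singular values of `X`, and a computed sketch `A` of `X` with Frobenius norm at most
`F` whose error is at most `K`. -/
structure SketchBounds {s m n : ℕ} (Om : Matrix (Fin s) (Fin m) ℝ) (X : Matrix (Fin m) (Fin n) ℝ)
    (A : Matrix (Fin s) (Fin n) ℝ) (α β σ K F : ℝ) : Prop where
  α_pos : 0 < α
  α_le : α ≤ β
  σ_pos : 0 < σ
  σ_le : ∀ x, σ * euclNorm x ≤ euclNorm (X *ᵥ x)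
  le_sketch : ∀ x, α * euclNorm (X *ᵥ x) ≤ euclNorm (Om *ᵥ (X *ᵥ x))
  sketch_le : ∀ x, euclNorm (Om *ᵥ (X *ᵥ x)) ≤ β * euclNorm (X *ᵥ x)
  error_le : frobNorm (A - Om * X) ≤ K
  K_le : 10.5 * K ≤ α * σ
  frob_le : frobNorm A ≤ F
  F_le : 110.25 * (((s : ℝ) + n + 1) * uRound * F ^ 2) ≤ (α * σ) ^ 2
  s_small : (s : ℝ) * uRound ≤ 1 / 128
  n_small : ((n : ℝ) + 1) * uRound ≤ 1 / 128
  n_sq_small : (n : ℝ) ^ 2 * uRound ≤ 1 / 64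

namespace SketchBounds

variable {s m n : ℕ} {Om : Matrix (Fin s) (Fin m) ℝ} {X W : Matrix (Fin m) (Fin n) ℝ}
  {A : Matrix (Fin s) (Fin n) ℝ} {G Y : Matrix (Fin n) (Fin n) ℝ} {α β σ K F : ℝ}

lemma F_nonneg (h : SketchBounds Om X A α β σ K F) : 0 ≤ F :=
  (frobNorm_nonneg A).trans h.frob_le

lemma σ_mul_le (h : SketchBounds Om X A α β σ K F) (x : Fin n → ℝ) :
    α * σ * euclNorm x ≤ α * euclNorm (X *ᵥ x) := by
  rw [mul_assoc]
  exact mul_le_mul_of_nonneg_left (h.σ_le x) h.α_pos.le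

/-- The absolute error `K ≤ ασ/10.5` becomes relative to `‖Xx‖` through `σ‖x‖ ≤ ‖Xx‖`. -/
lemma abs_sub_le (h : SketchBounds Om X A α β σ K F) (x : Fin n → ℝ) :
    euclNorm ((A - Om * X) *ᵥ x) ≤ 2 / 21 * (α * euclNorm (X *ᵥ x)) := by
  have h1 := (euclNorm_mulVec_le_frobNorm (A - Om * X) x).trans
    (mul_le_mul_of_nonneg_right h.error_le (euclNorm_nonneg x))
  have h2 := mul_le_mul_of_nonneg_right h.K_le (euclNorm_nonneg x)
  have h3 := h.σ_mul_le x
  linarith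

lemma le_mulVec (h : SketchBounds Om X A α β σ K F) (x : Fin n → ℝ) :
    19 / 21 * (α * euclNorm (X *ᵥ x)) ≤ euclNorm (A *ᵥ x) := by
  have h1 := euclNorm_sub_le (A *ᵥ x) ((A - Om * X) *ᵥ x)
  rw [← Matrix.sub_mulVec, sub_sub_cancel, ← Matrix.mulVec_mulVec] at h1
  linarith [h.le_sketch x, h.abs_sub_le x]

lemma mulVec_le (h : SketchBounds Om X A α β σ K F) (x : Fin n → ℝ) :
    euclNorm (A *ᵥ x) ≤ 23 / 21 * (β * euclNorm (X *ᵥ x)) := by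
  have h1 := euclNorm_add_le (Om *ᵥ (X *ᵥ x)) ((A - Om * X) *ᵥ x)
  rw [Matrix.mulVec_mulVec, ← Matrix.add_mulVec, add_sub_cancel, ← Matrix.mulVec_mulVec] at h1
  have h2 := mul_le_mul_of_nonneg_right h.α_le (euclNorm_nonneg (X *ᵥ x))
  linarith [h.sketch_le x, h.abs_sub_le x]

lemma gram_error_le (h : SketchBounds Om X A α β σ K F) :
    ((s : ℝ) + n + 1) * uRound * frobNorm A ^ 2 ≤ (α * σ) ^ 2 / 110.25 := by
  have h1 : 0 ≤ ((s : ℝ) + n + 1) * uRound := mul_nonneg (by positivity) uRound_pos.le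
  have h2 := mul_le_mul_of_nonneg_left
    (pow_le_pow_left₀ (frobNorm_nonneg A) h.frob_le 2) h1
  have h3 := h.F_le
  rw [le_div_iff₀ (by norm_num)]
  linarith

theorem not_flCholeskyBreaks (h : SketchBounds Om X A α β σ K F) (hG : FlMul Aᵀ A G) :
    ¬ FlCholeskyBreaks G := by
  have hασ : 0 < α * σ := mul_pos h.α_pos h.σ_pos
  refine hG.not_flCholeskyBreaks h.s_small h.n_small (lam := (19 / 21 * (α * σ)) ^ 2)
    (fun x => ?_) ?_
  · rw [← mul_pow]
    have := euclNorm_nonneg x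
    refine pow_le_pow_left₀ (by positivity) ?_ 2
    linarith [h.le_mulVec x, h.σ_mul_le x]
  · have h1 := h.gram_error_le
    have h2 : 0 < (α * σ) ^ 2 := by positivity
    rw [le_div_iff₀ (by norm_num)] at h1
    rw [mul_pow]
    linarith

lemma abs_sq_sub_sq_le (h : SketchBounds Om X A α β σ K F) (hG : FlMul Aᵀ A G)
    (hY : FlCholesky G Y) (x : Fin n → ℝ) :
    |euclNorm (Y *ᵥ x) ^ 2 - euclNorm (A *ᵥ x) ^ 2|
      ≤ 0.0095 * (α * euclNorm (X *ᵥ x)) ^ 2 := by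
  have hασ : 0 < α * σ := mul_pos h.α_pos h.σ_pos
  refine (abs_sq_euclNorm_sub_le Y A x).trans ?_
  have h1 := hG.frobNorm_flCholesky_gram_sub_le h.s_small h.n_small hY
  have h2 := h.gram_error_le
  rw [le_div_iff₀ (by norm_num)] at h2
  have h3 : frobNorm (Yᵀ * Y - Aᵀ * A) ≤ 0.0095 * (α * σ) ^ 2 := by
    have : 0 ≤ (α * σ) ^ 2 := by positivity
    linarith
  have h4 := mul_le_mul_of_nonneg_right h3 (sq_nonneg (euclNorm x))
  have h5 := pow_le_pow_left₀ (mul_nonneg hασ.le (euclNorm_nonneg x)) (h.σ_mul_le x) 2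
  rw [mul_pow] at h5
  linarith

/-- `(19/21)² - 0.0095 ≥ 0.899²`. -/
lemma le_factor (h : SketchBounds Om X A α β σ K F) (hG : FlMul Aᵀ A G)
    (hY : FlCholesky G Y) (x : Fin n → ℝ) :
    0.899 * (α * euclNorm (X *ᵥ x)) ≤ euclNorm (Y *ᵥ x) := by
  refine le_of_sq_le_sq_of_nonneg (euclNorm_nonneg _) ?_
  have h1 := (abs_le.1 (h.abs_sq_sub_sq_le hG hY x)).1
  have h0 : 0 ≤ α * euclNorm (X *ᵥ x) := mul_nonneg h.α_pos.le (euclNorm_nonneg _)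
  have h2 := pow_le_pow_left₀ (by positivity) (h.le_mulVec x) 2
  have h3 := sq_nonneg (α * euclNorm (X *ᵥ x))
  rw [mul_pow] at h2 ⊢
  linarith

lemma factor_le (h : SketchBounds Om X A α β σ K F) (hG : FlMul Aᵀ A G)
    (hY : FlCholesky G Y) (x : Fin n → ℝ) :
    euclNorm (Y *ᵥ x) ≤ 1.1 * (β * euclNorm (X *ᵥ x)) := by
  have h0 : 0 ≤ α * euclNorm (X *ᵥ x) := mul_nonneg h.α_pos.le (euclNorm_nonneg _)
  have h4 := mul_le_mul_of_nonneg_right h.α_le (euclNorm_nonneg (X *ᵥ x))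
  refine le_of_sq_le_sq_of_nonneg (by linarith) ?_
  have h1 := (abs_le.1 (h.abs_sq_sub_sq_le hG hY x)).2
  have h2 := pow_le_pow_left₀ (euclNorm_nonneg _) (h.mulVec_le x) 2
  have h3 := pow_le_pow_left₀ h0 h4 2
  have h5 := sq_nonneg (β * euclNorm (X *ᵥ x))
  rw [mul_pow] at h2 ⊢
  linarith

lemma frobNorm_factor_le (h : SketchBounds Om X A α β σ K F) (hG : FlMul Aᵀ A G)
    (hY : FlCholesky G Y) : frobNorm Y ≤ 1.01 * F := by
  linarith [hG.frobNorm_flCholesky_le h.s_small h.n_small hY, h.frob_le]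

lemma frobNorm_solve_sub_le (h : SketchBounds Om X A α β σ K F) (hG : FlMul Aᵀ A G)
    (hY : FlCholesky G Y) (hW : FlSolve X Y W) :
    frobNorm (W * Y - X) ≤ 1.0201 * (n * √n * uRound) * norm2 W * F := by
  have hu := uRound_pos
  have hn : (n : ℝ) * uRound ≤ 1 / 128 := by linarith [h.n_small]
  have h1 := hW.frobNorm_sub_le hn hY
  have hN := norm2_nonneg W
  have hF := h.F_nonneg
  have h2 : frobNorm W * frobNorm Y ≤ √n * norm2 W * (1.01 * F) :=
    mul_le_mul (frobNorm_le_sqrt_cols W) (h.frobNorm_factor_le hG hY) (frobNorm_nonneg _)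
      (by positivity)
  have h3 := mul_le_mul_of_nonneg_left h2 (show 0 ≤ 1.01 * (n * uRound) by positivity)
  linarith

lemma solve_error_le (h : SketchBounds Om X A α β σ K F) (hG : FlMul Aᵀ A G)
    (hY : FlCholesky G Y) (hW : FlSolve X Y W) (x : Fin n → ℝ) :
    euclNorm ((W * Y - X) *ᵥ x) ≤ 0.01215 * (α * norm2 W) * euclNorm (X *ᵥ x) := by
  have hασ : 0 < α * σ := mul_pos h.α_pos h.σ_pos
  have hu := uRound_pos
  have hN := norm2_nonneg W
  have hF := h.F_nonneg
  -- The square is `n²u · nuF²`, at most `1/64 · (ασ/10.5)²`, and `8 · 10.5 = 84`.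
  have h1 : n * √n * uRound * F ≤ α * σ / 84 := by
    refine le_of_sq_le_sq_of_nonneg (by positivity) ?_
    have h2 : (n * √n * uRound * F) ^ 2 = (n : ℝ) ^ 2 * uRound * (n * uRound * F ^ 2) := by
      rw [mul_pow, mul_pow, mul_pow, Real.sq_sqrt n.cast_nonneg]; ring
    have h3 : 110.25 * (n * uRound * F ^ 2) ≤ (α * σ) ^ 2 := by
      have h4 : 0 ≤ ((s : ℝ) + 1) * uRound * F ^ 2 := by positivity
      linarith [h.F_le]
    have h5 : (n : ℝ) ^ 2 * uRound * (n * uRound * F ^ 2)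
        ≤ 1 / 64 * ((α * σ) ^ 2 / 110.25) := by
      refine mul_le_mul h.n_sq_small ?_ (by positivity) (by norm_num)
      rw [le_div_iff₀ (by norm_num)]
      linarith
    rw [h2]
    refine h5.trans (le_of_eq ?_)
    rw [div_pow]
    norm_num
    ring
  have h2 := (euclNorm_mulVec_le_frobNorm (W * Y - X) x).trans
    (mul_le_mul_of_nonneg_right (h.frobNorm_solve_sub_le hG hY hW) (euclNorm_nonneg x))
  have h3 := mul_le_mul_of_nonneg_right h1 (mul_nonneg hN (euclNorm_nonneg x))
  have h4 := mul_le_mul_of_nonneg_right (h.σ_mul_le x) hN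
  have h5 : 0 ≤ α * σ * euclNorm x * norm2 W := by
    have := euclNorm_nonneg x
    positivity
  linarith

/-- Every vector is `Y x` for some `x`. -/
lemma exists_mulVec_eq (hY : FlCholesky G Y) (y : Fin n → ℝ) : ∃ x, Y *ᵥ x = y :=
  ⟨Y⁻¹ *ᵥ y, by rw [Matrix.mulVec_mulVec, Matrix.mul_nonsing_inv _ hY.isUnit_det,
    Matrix.one_mulVec]⟩

/-- On `y = Yx`, `Wy` is `Xx` plus an error proportional to `‖W‖₂`; the small coefficient allows
this error to be absorbed. -/
theorem norm2_precond_le (h : SketchBounds Om X A α β σ K F) (hG : FlMul Aᵀ A G)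
    (hY : FlCholesky G Y) (hW : FlSolve X Y W) : α * norm2 W ≤ 1.13 := by
  have hα := h.α_pos
  have hN := norm2_nonneg W
  have h1 : norm2 W ≤ (1 + 0.01215 * (α * norm2 W)) / (0.899 * α) := by
    refine norm2_le (by positivity) fun y => ?_
    obtain ⟨x, rfl⟩ := exists_mulVec_eq hY y
    have h2 := euclNorm_add_le (X *ᵥ x) ((W * Y - X) *ᵥ x)
    rw [← Matrix.add_mulVec, add_sub_cancel, ← Matrix.mulVec_mulVec] at h2
    have h3 := h.solve_error_le hG hY hW x
    have h4 := mul_le_mul_of_nonneg_left (h.le_factor hG hY x)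
      (show 0 ≤ 1 + 0.01215 * (α * norm2 W) by positivity)
    rw [div_mul_eq_mul_div, le_div_iff₀ (by positivity)]
    refine le_trans ?_ h4
    have h5 := mul_le_mul_of_nonneg_right (h2.trans (add_le_add_right h3 _))
      (show 0 ≤ 0.899 * α by positivity)
    linarith
  rw [le_div_iff₀ (by positivity)] at h1
  linarith

theorem le_precond_mulVec (h : SketchBounds Om X A α β σ K F) (hG : FlMul Aᵀ A G)
    (hY : FlCholesky G Y) (hW : FlSolve X Y W) (y : Fin n → ℝ) :
    0.87 / β * euclNorm y ≤ euclNorm (W *ᵥ y) := by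
  have hβ : 0 < β := h.α_pos.trans_le h.α_le
  obtain ⟨x, rfl⟩ := exists_mulVec_eq hY y
  have h2 := euclNorm_sub_le ((W * Y) *ᵥ x) ((W * Y - X) *ᵥ x)
  rw [← Matrix.sub_mulVec, sub_sub_cancel, ← Matrix.mulVec_mulVec] at h2
  have h3 := h.solve_error_le hG hY hW x
  have h4 := mul_le_mul_of_nonneg_right (h.norm2_precond_le hG hY hW) (euclNorm_nonneg (X *ᵥ x))
  have h5 := h.factor_le hG hY x
  rw [div_mul_eq_mul_div, div_le_iff₀ hβ]
  have h6 : 0.98 * euclNorm (X *ᵥ x) ≤ euclNorm (W *ᵥ (Y *ᵥ x)) := by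
    linarith [euclNorm_nonneg (X *ᵥ x)]
  have h7 := mul_le_mul_of_nonneg_right h6 hβ.le
  have h8 : 0 ≤ β * euclNorm (X *ᵥ x) := mul_nonneg hβ.le (euclNorm_nonneg _)
  linarith

lemma norm2_factor_le (h : SketchBounds Om X A α β σ K F) (hG : FlMul Aᵀ A G)
    (hY : FlCholesky G Y) : norm2 Y ≤ 1.1 * (β * norm2 X) := by
  have hβ : 0 < β := h.α_pos.trans_le h.α_le
  have hX := norm2_nonneg X
  refine norm2_le (by positivity) fun x => (h.factor_le hG hY x).trans ?_
  have := mul_le_mul_of_nonneg_left (euclNorm_mulVec_le X x) hβ.le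
  linarith

end SketchBounds

/-! ### Sparse matrices -/

lemma abs_le_maxAbs {m n : ℕ} (X : Matrix (Fin m) (Fin n) ℝ) (i : Fin m) (j : Fin n) :
    |X i j| ≤ maxAbs X :=
  le_ciSup (f := fun p : Fin m × Fin n => |X p.1 p.2|) (Set.finite_range _).bddAbove (i, j)

lemma maxAbs_nonneg {m n : ℕ} (X : Matrix (Fin m) (Fin n) ℝ) : 0 ≤ maxAbs X :=
  Real.iSup_nonneg fun _ => abs_nonneg _

lemma sum_sq_col_le {m n : ℕ} (X : Matrix (Fin m) (Fin n) ℝ) (j : Fin n) :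
    ∑ i, X i j ^ 2 ≤ colNnz X j * maxAbs X ^ 2 := by
  rw [colNnz, ← nsmul_eq_mul, ← Finset.sum_const, Finset.sum_filter]
  refine Finset.sum_le_sum fun i _ => ?_
  split_ifs with h
  · rw [← sq_abs]
    exact pow_le_pow_left₀ (abs_nonneg _) (abs_le_maxAbs X i j) 2
  · rw [not_not.1 h]; simp

lemma IsT1.sum_colNnz_le {m n : ℕ} {X : Matrix (Fin m) (Fin n) ℝ} {v t₁ t₂ : ℕ}
    (h : IsT1 X v t₁ t₂) : ∑ j, colNnz X j ≤ v * t₁ + n * t₂ := by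
  classical
  obtain ⟨D, hD, h1, h2⟩ := h.dense
  calc ∑ j, colNnz X j = ∑ j ∈ D, colNnz X j + ∑ j ∈ Dᶜ, colNnz X j :=
        (Finset.sum_add_sum_compl D _).symm
    _ ≤ D.card * t₁ + Dᶜ.card * t₂ :=
        add_le_add (Finset.sum_le_card_nsmul _ _ _ h1)
          (Finset.sum_le_card_nsmul _ _ _ fun j hj => h2 j (Finset.mem_compl.1 hj))
    _ ≤ v * t₁ + n * t₂ := by
        rw [hD]
        refine Nat.add_le_add_left (Nat.mul_le_mul_right _ ?_) _
        simpa using Finset.card_le_univ Dᶜ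

lemma IsT1.frobNorm_le {m n : ℕ} {X : Matrix (Fin m) (Fin n) ℝ} {v t₁ t₂ : ℕ}
    (h : IsT1 X v t₁ t₂) : frobNorm X ≤ maxAbs X * √(v * t₁ + n * t₂) := by
  refine le_of_sq_le_sq_of_nonneg (mul_nonneg (maxAbs_nonneg X) (Real.sqrt_nonneg _)) ?_
  rw [mul_pow, Real.sq_sqrt (by positivity), sq_frobNorm, Finset.sum_comm]
  refine (Finset.sum_le_sum fun j _ => sum_sq_col_le X j).trans ?_
  rw [← Finset.sum_mul, mul_comm]
  refine mul_le_mul_of_nonneg_left ?_ (sq_nonneg _)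
  exact_mod_cast h.sum_colNnz_le

/-! ### The embedding event -/

/-- The embedding condition is an intersection of closed conditions on the entries of the matrix,
one for each pair `x, y`. -/
lemma measurableSet_isSubspaceEmbedding {Ω' : Type*} [MeasurableSpace Ω'] {s m : ℕ} (ε : ℝ)
    {Om : Ω' → Matrix (Fin s) (Fin m) ℝ} (hmeas : ∀ i j, Measurable fun ω => Om ω i j)
    (K : Submodule ℝ (EuclideanSpace ℝ (Fin m))) :
    MeasurableSet {ω | IsSubspaceEmbedding ε (Om ω) K} := by
  have hclosed : IsClosed {S : Fin s → Fin m → ℝ | IsSubspaceEmbedding ε (Matrix.of S) K} := by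
    simp only [IsSubspaceEmbedding, Set.ofPred_forall]
    refine isClosed_iInter fun x => isClosed_iInter fun _ => isClosed_iInter fun y =>
      isClosed_iInter fun _ => isClosed_le ?_ continuous_const
    simp only [Matrix.toLpLin_apply, PiLp.inner_apply, Matrix.mulVec, dotProduct,
      Matrix.of_apply, RCLike.inner_apply, conj_trivial]
    fun_prop
  have hOm : Measurable fun (ω : Ω') (i : Fin s) (j : Fin m) => Om ω i j :=
    measurable_pi_lambda _ fun i => measurable_pi_lambda _ fun j => hmeas i j
  exact hOm hclosed.measurableSet

lemma IsSubspaceEmbedding.abs_sq_sub_sq_le {s m n : ℕ} {ε : ℝ} {S : Matrix (Fin s) (Fin m) ℝ}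
    {X : Matrix (Fin m) (Fin n) ℝ}
    (h : IsSubspaceEmbedding ε S (LinearMap.range (Matrix.toEuclideanLin X))) (x : Fin n → ℝ) :
    |euclNorm (X *ᵥ x) ^ 2 - euclNorm (S *ᵥ (X *ᵥ x)) ^ 2| ≤ ε * euclNorm (X *ᵥ x) ^ 2 := by
  have hx : WithLp.toLp 2 (X *ᵥ x) ∈ LinearMap.range (Matrix.toEuclideanLin X) :=
    ⟨WithLp.toLp 2 x, rfl⟩
  have h1 := h _ hx _ hx
  rw [real_inner_self_eq_norm_sq, real_inner_self_eq_norm_sq, mul_assoc, ← sq] at h1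
  exact h1

lemma IsSubspaceEmbedding.le_mulVec {s m n : ℕ} {ε : ℝ} {S : Matrix (Fin s) (Fin m) ℝ}
    {X : Matrix (Fin m) (Fin n) ℝ} (hε : ε ≤ 1)
    (h : IsSubspaceEmbedding ε S (LinearMap.range (Matrix.toEuclideanLin X))) (x : Fin n → ℝ) :
    √(1 - ε) * euclNorm (X *ᵥ x) ≤ euclNorm (S *ᵥ (X *ᵥ x)) := by
  refine le_of_sq_le_sq_of_nonneg (euclNorm_nonneg _) ?_
  rw [mul_pow, Real.sq_sqrt (by linarith)]
  linarith [(abs_le.1 (h.abs_sq_sub_sq_le x)).2]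

lemma IsSubspaceEmbedding.mulVec_le {s m n : ℕ} {ε : ℝ} {S : Matrix (Fin s) (Fin m) ℝ}
    {X : Matrix (Fin m) (Fin n) ℝ} (hε : 0 ≤ ε)
    (h : IsSubspaceEmbedding ε S (LinearMap.range (Matrix.toEuclideanLin X))) (x : Fin n → ℝ) :
    euclNorm (S *ᵥ (X *ᵥ x)) ≤ √(1 + ε) * euclNorm (X *ᵥ x) := by
  refine le_of_sq_le_sq_of_nonneg (mul_nonneg (Real.sqrt_nonneg _) (euclNorm_nonneg _)) ?_
  rw [mul_pow, Real.sq_sqrt (by linarith)]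
  linarith [(abs_le.1 (h.abs_sq_sub_sq_le x)).1]

/-- The embedding is applied to each column of `X`; this avoids the much larger `‖Ω‖₂` in the main
term of `‖A‖_F`. -/
lemma frobNorm_mul_le_of_mulVec_le {l m n : ℕ} {S : Matrix (Fin l) (Fin m) ℝ}
    {X : Matrix (Fin m) (Fin n) ℝ} {β : ℝ} (hβ : 0 ≤ β)
    (h : ∀ x, euclNorm (S *ᵥ (X *ᵥ x)) ≤ β * euclNorm (X *ᵥ x)) :
    frobNorm (S * X) ≤ β * frobNorm X := by
  refine le_of_sq_le_sq_of_nonneg (mul_nonneg hβ (frobNorm_nonneg _)) ?_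
  rw [mul_pow, sq_frobNorm_eq_sum_col, sq_frobNorm_eq_sum_col X, Finset.mul_sum]
  refine Finset.sum_le_sum fun j _ => ?_
  have h1 := h (Pi.single j 1)
  rw [Matrix.mulVec_mulVec, Matrix.mulVec_single_one, Matrix.mulVec_single_one] at h1
  rw [← mul_pow]
  exact pow_le_pow_left₀ (euclNorm_nonneg _) h1 2

/-! ### The conditions on the constants -/

lemma mul_le_of_le_div_of_pos {q a d : ℝ} (hq : 0 < q) (hd : 0 ≤ d) (h : q ≤ a / d) :
    d * q ≤ a := by
  -- A vanishing denominator is harmless: by convention `a / 0 = 0`, which contradicts `0 < q ≤ a /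
  -- 0`.
  rcases hd.eq_or_lt with rfl | hd
  · rw [div_zero] at h; linarith
  · rwa [le_div_iff₀ hd, mul_comm] at h

lemma kOne_nonneg {s m : ℕ} (Om : Matrix (Fin s) (Fin m) ℝ) (n v t₁ t₂ : ℕ) :
    0 ≤ kOne Om n v t₁ t₂ := by
  have := uRound_pos
  have := norm2_nonneg Om
  unfold kOne; positivity

/-- Both bounds are the two entries of the minimum `r₁`, cleared of denominators and multiplied by
`σ_n(X)`, since `η κ₂(X) σ_n(X) = c`. -/
lemma cond_le_rOne {s m n : ℕ} {Om : Matrix (Fin s) (Fin m) ℝ} {X : Matrix (Fin m) (Fin n) ℝ}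
    {ε : ℝ} {v t₁ t₂ : ℕ} (hε : ε ≤ 1) (hσ : 0 < sigmaLast X) (hX : 0 < norm2 X)
    (h : cond2 X ≤ rOne Om X ε v t₁ t₂) :
    10.5 * (maxAbs X * kOne Om n v t₁ t₂) ≤ √(1 - ε) * sigmaLast X ∧
      110.25 * (((s : ℝ) + n + 1) * uRound *
        (maxAbs X * (√(1 + ε) * √(v * t₁ + n * t₂) + kOne Om n v t₁ t₂)) ^ 2)
        ≤ (√(1 - ε) * sigmaLast X) ^ 2 := by
  have hu := uRound_pos
  have hc := maxAbs_nonneg X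
  have hk := kOne_nonneg Om n v t₁ t₂
  have hη : 0 ≤ eta X := div_nonneg hc hX.le
  have hq : 0 < cond2 X := div_pos hX hσ
  have hηq : eta X * cond2 X * sigmaLast X = maxAbs X := by
    rw [eta, cond2]; field_simp
  obtain ⟨h1, h2⟩ := le_min_iff.1 h
  constructor
  · have h3 := mul_le_of_le_div_of_pos hq (by positivity) h1
    have h4 := mul_le_mul_of_nonneg_right h3 hσ.le
    rw [← hηq]
    linarith
  · set D := √(1 + ε) * √(v * t₁ + n * t₂) + kOne Om n v t₁ t₂ with hD
    have hD0 : 0 ≤ D := by positivity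
    rw [one_div_mul_eq_div] at h2
    have h3 := mul_le_of_le_div_of_pos hq (by positivity) h2
    have hw : 0 < (s : ℝ) * uRound + (n + 1) * uRound := by positivity
    have h4 := mul_le_mul_of_nonneg_right h3 hσ.le
    have h5 : 10.5 * (maxAbs X * D)
        ≤ √((1 - ε) / (s * uRound + (n + 1) * uRound)) * sigmaLast X := by
      rw [← hηq]; linarith
    have h6 := pow_le_pow_left₀ (by positivity) h5 2
    rw [mul_pow, mul_pow √_, Real.sq_sqrt (div_nonneg (by linarith) hw.le), div_mul_eq_mul_div,
      le_div_iff₀ hw] at h6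
    rw [mul_pow √_, Real.sq_sqrt (by linarith)]
    norm_num at h6 ⊢
    linarith

lemma bConst_bounds {m n : ℕ} {ε : ℝ} (hε₀ : 0 ≤ ε) (hε₁ : ε < 1) (hrt : 0 < roundTerm m n)
    (h : 32 / 3 * √(roundTerm m n) + 2 / 87 ≤ √(1 - ε) / √(1 + ε)) :
    64 * (bConst ε ^ 2 * roundTerm m n) ≤ 1 ∧
      1.16 / √(1 - ε) ≤ bConst ε * (0.87 / √(1 + ε)) := by
  have hα : 0 < √(1 - ε) := Real.sqrt_pos.2 (by linarith)
  have hβ : 0 < √(1 + ε) := Real.sqrt_pos.2 (by linarith)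
  have hb : bConst ε = 1.16 / (0.87 * (√(1 - ε) / √(1 + ε)) - 0.02) := by
    rw [bConst, Real.sqrt_div (by linarith)]
  have hr : 0 < √(roundTerm m n) := Real.sqrt_pos.2 hrt
  -- The assumption times `0.87`. As `9.28 = 8 · 1.16`, it says `8 b √(roundTerm m n) ≤ 1`.
  have hden : 9.28 * √(roundTerm m n) ≤ 0.87 * (√(1 - ε) / √(1 + ε)) - 0.02 := by linarith
  have hden0 : 0 < 0.87 * (√(1 - ε) / √(1 + ε)) - 0.02 := by linarith
  constructor
  · rw [hb, div_pow, div_mul_eq_mul_div, mul_div_assoc', div_le_one (by positivity)]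
    have h1 := pow_le_pow_left₀ (by positivity) hden 2
    rw [mul_pow, Real.sq_sqrt hrt.le] at h1
    norm_num at h1 ⊢
    linarith
  · rw [hb, div_mul_div_comm]
    rw [div_le_div_iff₀ hα (by positivity)]
    have h1 : (0.87 * (√(1 - ε) / √(1 + ε)) - 0.02) * √(1 + ε) ≤ 0.87 * √(1 - ε) := by
      have h2 : √(1 - ε) / √(1 + ε) * √(1 + ε) = √(1 - ε) := div_mul_cancel₀ _ hβ.ne'
      linarith
    linarith

/-! ### The residual -/

section Residual

variable {s m n : ℕ} {Om : Matrix (Fin s) (Fin m) ℝ} {X W Q : Matrix (Fin m) (Fin n) ℝ}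
  {A : Matrix (Fin s) (Fin n) ℝ} {G Y C Z R : Matrix (Fin n) (Fin n) ℝ} {α β σ K F H : ℝ}

/-- `QR - X = (WY - X) + (QZ - W)Y + Q(R - ZY)`, each bracket being the backward error of one
operation. Estimating `Y` in the middle term by its spectral norm gives `β‖X‖₂` in place of `F`. -/
theorem SketchBounds.residual_le (h : SketchBounds Om X A α β σ K F)
    (hm : (m : ℝ) * uRound ≤ 1 / 128) (hG : FlMul Aᵀ A G)
    (hY : FlCholesky G Y) (hW : FlSolve X Y W) (hC : FlMul Wᵀ W C) (hZ : FlCholesky C Z)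
    (hQ : FlSolve W Z Q) (hR : FlMul Z Y R) (hH : norm2 Q ≤ H) :
    frobNorm (Q * R - X) ≤ (1.32 + 1.34 * H) / α * F * (n * √n * uRound) +
      1.34 * H / α * β * (n ^ 2 * uRound * norm2 X) := by
  have hu := uRound_pos
  have hα := h.α_pos
  have hβ : 0 < β := h.α_pos.trans_le h.α_le
  have hF := h.F_nonneg
  have hX := norm2_nonneg X
  have hN0 := norm2_nonneg W
  have hH0 : 0 ≤ H := (norm2_nonneg Q).trans hH
  have hN : norm2 W ≤ 1.13 / α := by
    rw [le_div_iff₀ hα, mul_comm]; exact h.norm2_precond_le hG hY hW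
  have hn' : (n : ℝ) * uRound ≤ 1 / 128 := by linarith [h.n_small]
  have hZF : frobNorm Z ≤ 1.01 * (√n * norm2 W) := by
    linarith [hC.frobNorm_flCholesky_le hm h.n_small hZ, frobNorm_le_sqrt_cols W]
  have hYF := h.frobNorm_factor_le hG hY
  have hsplit : Q * R - X = (W * Y - X) + (Q * Z - W) * Y + Q * (R - Z * Y) := by
    rw [Matrix.sub_mul, Matrix.mul_sub, Matrix.mul_assoc]; abel
  set a := (n : ℝ) * √n * uRound with ha
  have ha0 : 0 ≤ a := by positivity
  have hnn := Real.mul_self_sqrt (n.cast_nonneg (α := ℝ))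
  have h1 : frobNorm (W * Y - X) ≤ 1.32 * (1 / α * F * a) := by
    refine (h.frobNorm_solve_sub_le hG hY hW).trans ?_
    have h2 := mul_le_mul_of_nonneg_left hN (mul_nonneg ha0 hF)
    have h3 : 0 ≤ 1 / α * F * a := by positivity
    have h4 : a * F * (1.13 / α) = 1.13 * (1 / α * F * a) := by ring
    linarith
  have h2 : frobNorm ((Q * Z - W) * Y) ≤ 1.34 * (H / α * β * (n ^ 2 * uRound * norm2 X)) := by
    have e1 := hQ.frobNorm_sub_le hn' hZ
    have e2 : frobNorm Q * frobNorm Z ≤ (√n * H) * (1.01 * (√n * norm2 W)) :=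
      mul_le_mul ((frobNorm_le_sqrt_cols Q).trans
        (mul_le_mul_of_nonneg_left hH (Real.sqrt_nonneg _))) hZF (frobNorm_nonneg _) (by positivity)
    have e3 := mul_le_mul_of_nonneg_left e2 (show 0 ≤ 1.01 * (n * uRound) by positivity)
    have e4 : 1.01 * (n * uRound) * ((√n * H) * (1.01 * (√n * norm2 W)))
        = 1.0201 * (n ^ 2 * uRound * H) * norm2 W := by
      linear_combination 1.0201 * (n * uRound * H * norm2 W) * hnn
    have e5 := mul_le_mul_of_nonneg_left hN (show 0 ≤ 1.0201 * (n ^ 2 * uRound * H) by positivity)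
    have e6 : frobNorm (Q * Z - W) ≤ 1.0201 * (n ^ 2 * uRound * H) * (1.13 / α) := by linarith
    refine (frobNorm_mul_le_norm2_right _ _).trans ?_
    refine (mul_le_mul e6 (h.norm2_factor_le hG hY) (norm2_nonneg _) (by positivity)).trans ?_
    have e7 : 1.0201 * (n ^ 2 * uRound * H) * (1.13 / α) * (1.1 * (β * norm2 X))
        = 1.0201 * 1.13 * 1.1 * (H / α * β * (n ^ 2 * uRound * norm2 X)) := by ring
    rw [e7]
    exact mul_le_mul_of_nonneg_right (by norm_num) (by positivity)
  have h3 : frobNorm (Q * (R - Z * Y)) ≤ 1.34 * (H / α * F * a) := by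
    have e1 := hR.frobNorm_sub_le hn'
    have e2 : frobNorm Z * frobNorm Y ≤ 1.01 * (√n * (1.13 / α)) * (1.01 * F) :=
      mul_le_mul (hZF.trans (mul_le_mul_of_nonneg_left
        (mul_le_mul_of_nonneg_left hN (Real.sqrt_nonneg _)) (by norm_num))) hYF
        (frobNorm_nonneg _) (by positivity)
    have e3 := e1.trans (mul_le_mul_of_nonneg_left e2 (show 0 ≤ 1.01 * (n * uRound) by positivity))
    refine (frobNorm_mul_le_norm2_left _ _).trans
      ((mul_le_mul hH e3 (frobNorm_nonneg _) hH0).trans ?_)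
    have e4 : H * (1.01 * (n * uRound) * (1.01 * (√n * (1.13 / α)) * (1.01 * F)))
        = 1.01 * 1.01 * 1.13 * 1.01 * (H / α * F * a) := by rw [ha]; ring
    rw [e4]
    exact mul_le_mul_of_nonneg_right (by norm_num) (by positivity)
  rw [hsplit]
  refine (frobNorm_add_le _ _).trans ((add_le_add_left (frobNorm_add_le _ _) _).trans ?_)
  have h4 : (1.32 + 1.34 * H) / α * F * a + 1.34 * H / α * β * (n ^ 2 * uRound * norm2 X)
      = 1.32 * (1 / α * F * a) + 1.34 * (H / α * β * (n ^ 2 * uRound * norm2 X))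
        + 1.34 * (H / α * F * a) := by ring
  rw [h4]
  exact add_le_add (add_le_add h1 h2) h3

end Residual

/-- The bounds of the preconditioning step hold for every embedding satisfying the condition on
`κ₂(X)`. -/
theorem IsSubspaceEmbedding.sketchBounds {s m n : ℕ} {Om : Matrix (Fin s) (Fin m) ℝ}
    {X : Matrix (Fin m) (Fin n) ℝ} {A : Matrix (Fin s) (Fin n) ℝ} {ε : ℝ} {v t₁ t₂ : ℕ}
    (hε₀ : 0 ≤ ε) (hε₁ : ε < 1) (hX : 0 < norm2 X) (hσ : 0 < sigmaLast X)
    (hT : IsT1 X v t₁ t₂) (hsm : s ≤ m) (hm : (m : ℝ) * uRound ≤ 1 / 128)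
    (hn : ((n : ℝ) + 1) * uRound ≤ 1 / 128) (hn2 : (n : ℝ) ^ 2 * uRound ≤ 1 / 64)
    (h : IsSubspaceEmbedding ε Om (LinearMap.range (Matrix.toEuclideanLin X)))
    (hcond : cond2 X ≤ rOne Om X ε v t₁ t₂) (hA : FlMul Om X A) :
    SketchBounds Om X A √(1 - ε) √(1 + ε) (sigmaLast X) (maxAbs X * kOne Om n v t₁ t₂)
      (maxAbs X * (√(1 + ε) * √(v * t₁ + n * t₂) + kOne Om n v t₁ t₂)) := by
  have hu := uRound_pos
  have hΩ := norm2_nonneg Om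
  obtain ⟨hK, hF⟩ := cond_le_rOne hε₁.le hσ hX hcond
  have hXF := hT.frobNorm_le
  have herr : frobNorm (A - Om * X) ≤ maxAbs X * kOne Om n v t₁ t₂ := by
    refine (hA.frobNorm_sub_le hm).trans ?_
    have h1 := mul_le_mul (frobNorm_le_sqrt_rows Om) hXF (frobNorm_nonneg _) (by positivity)
    refine (mul_le_mul_of_nonneg_left h1 (by positivity)).trans ?_
    have h2 : 0 ≤ m * uRound * (√s * norm2 Om * (maxAbs X * √(v * t₁ + n * t₂))) := by
      have := maxAbs_nonneg X
      positivity
    rw [kOne]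
    linarith
  exact
    { α_pos := Real.sqrt_pos.2 (by linarith)
      α_le := Real.sqrt_le_sqrt (by linarith)
      σ_pos := hσ
      σ_le := sigmaLast_mul_le X
      le_sketch := h.le_mulVec hε₁.le
      sketch_le := h.mulVec_le hε₀
      error_le := herr
      K_le := hK
      frob_le := by
        have h1 := frobNorm_add_le (Om * X) (A - Om * X)
        rw [add_sub_cancel] at h1
        have h2 := frobNorm_mul_le_of_mulVec_le (Real.sqrt_nonneg _) (h.mulVec_le hε₀)
        have h3 := mul_le_mul_of_nonneg_left hXF (Real.sqrt_nonneg (1 + ε))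
        linarith
      F_le := hF
      s_small :=
        (mul_le_mul_of_nonneg_right (Nat.cast_le.2 hsm) hu.le).trans hm
      n_small := hn
      n_sq_small := hn2 }

end RCholQR

end

/-! ### The theorem on the embedding event -/

open RCholQR

theorem theorem3p3 {Ω' : Type*} [MeasurableSpace Ω'] (μ : Measure Ω') [IsProbabilityMeasure μ]
    (m n s : ℕ) (g : ℝ) (hg : 1 ≤ g) (hmn : g * (n : ℝ) ≤ (m : ℝ)) (hns : n ≤ s) (hsm : s ≤ m)
    (X : Matrix (Fin m) (Fin n) ℝ) (hrank : X.rank = n)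
    (v t₁ t₂ : ℕ) (hT : RCholQR.IsT1 X v t₁ t₂)
    (ε p : ℝ) (hε₀ : 0 ≤ ε) (hε₁ : ε < 1)
    (Om : Ω' → Matrix (Fin s) (Fin m) ℝ) (hmeas : ∀ i j, Measurable fun ω => Om ω i j)
    (hOm : RCholQR.IsObliviousEmbedding μ Om ε p n)
    (h31 : (m : ℝ) * n * RCholQR.uRound ≤ 1 / 64)
    (h32 : (n : ℝ) * (n + 1) * RCholQR.uRound ≤ 1 / 64)
    (ha51 : 32 / 3 * √(RCholQR.roundTerm m n) + 2 / 87 ≤ √(1 - ε) / √(1 + ε)) :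
    ∃ E : Set Ω', MeasurableSet E ∧ 1 - p ≤ μ.real E ∧
      ∀ ω ∈ E, RCholQR.cond2 X ≤ RCholQR.rOne (Om ω) X ε v t₁ t₂ →
        ¬ RCholQR.SRCholeskyQR2Breaks (Om ω) X ∧
        ∀ (Q : Matrix (Fin m) (Fin n) ℝ) (R : Matrix (Fin n) (Fin n) ℝ),
          RCholQR.FlSRCholeskyQR2 (Om ω) X Q R →
            RCholQR.frobNorm (Qᵀ * Q - 1)
                ≤ 5 * RCholQR.bConst ε ^ 2 * RCholQR.roundTerm m n ∧
            RCholQR.frobNorm (Q * R - X) ≤ RCholQR.uThree (Om ω) X ε v t₁ t₂ := by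
  have hu := uRound_pos
  -- From `0 < v < n`. This halves the assumed bounds `1/64`, giving `mu ≤ 1/128` and `(n + 1)u ≤
  -- 1/128`.
  have hn2 : 2 ≤ n := by have := hT.v_pos; have := hT.v_lt; omega
  have hn2' : (2 : ℝ) ≤ n := by exact_mod_cast hn2
  have hm0 : (0 : ℝ) < m := by nlinarith
  have hσ : 0 < sigmaLast X := sigmaLast_pos (by omega) hrank
  have hX : 0 < norm2 X := by
    have : Nonempty (Fin n) := ⟨⟨0, by omega⟩⟩
    have h0 : (1 : Fin n → ℝ) ≠ 0 := one_ne_zero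
    have h1 := (sigmaLast_mul_le X 1).trans (euclNorm_mulVec_le X 1)
    exact hσ.trans_le (le_of_mul_le_mul_right h1 (euclNorm_pos h0))
  have hm : (m : ℝ) * uRound ≤ 1 / 128 := by
    have := mul_le_mul_of_nonneg_right hn2' (mul_nonneg hm0.le hu.le)
    linarith
  have hn : ((n : ℝ) + 1) * uRound ≤ 1 / 128 := by
    have := mul_le_mul_of_nonneg_right hn2' (show 0 ≤ ((n : ℝ) + 1) * uRound by positivity)
    linarith
  have hnsq : (n : ℝ) ^ 2 * uRound ≤ 1 / 64 := by
    have : 0 ≤ (n : ℝ) * uRound := by positivity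
    linarith
  have hrt0 : 0 < roundTerm m n := by unfold roundTerm; positivity
  have hrt : roundTerm m n ≤ 1 / 32 := by unfold roundTerm; linarith
  obtain ⟨hb1, hb2⟩ := bConst_bounds hε₀ hε₁ hrt0 ha51
  have hτ : 0 < 0.87 / √(1 + ε) := div_pos (by norm_num) (Real.sqrt_pos.2 (by linarith))
  refine ⟨{ω | IsSubspaceEmbedding ε (Om ω) (LinearMap.range (Matrix.toEuclideanLin X))},
    measurableSet_isSubspaceEmbedding ε hmeas _,
    hOm _ ((finrank_range_toEuclideanLin X).trans hrank), fun ω hω hcond => ?_⟩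
  have hsk : ∀ {A}, FlMul (Om ω) X A → _ := fun {A} hA =>
    IsSubspaceEmbedding.sketchBounds hε₀ hε₁ hX hσ hT hsm hm hn hnsq hω hcond hA
  have hα : 0 < √(1 - ε) := Real.sqrt_pos.2 (by linarith)
  have hWb : ∀ {A W G Y}, FlMul (Om ω) X A → FlMul Aᵀ A G → FlCholesky G Y → FlSolve X Y W →
      norm2 W ≤ bConst ε * (0.87 / √(1 + ε)) := by
    intro A W G Y hA hG hY hW
    refine le_trans ?_ hb2
    rw [le_div_iff₀ hα, mul_comm]
    linarith [(hsk hA).norm2_precond_le hG hY hW]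
  constructor
  · rintro (⟨A, G, hA, hG, hbr⟩ | ⟨W, Y, C, ⟨A, G, hA, hG, hY, hW⟩, hC, hbr⟩)
    · exact (hsk hA).not_flCholeskyBreaks hG hbr
    · exact hC.not_flCholeskyBreaks_of_norm2_le hm hn hτ (hWb hA hG hY hW)
        ((hsk hA).le_precond_mulVec hG hY hW) hb1 hbr
  · rintro Q R ⟨W, Y, Z, ⟨A, G, hA, hG, hY, hW⟩, ⟨C, hC, hZ, hQ⟩, hR⟩
    have horth := FlCholeskyQR.frobNorm_gram_sub_one_le hm hn hrt hτ (hWb hA hG hY hW)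
      ((hsk hA).le_precond_mulVec hG hY hW) hb1 hC hZ hQ
    refine ⟨horth, ?_⟩
    have hres := (hsk hA).residual_le hm hG hY hW hC hZ hQ hR (norm2_le_of_gram horth)
    refine hres.trans ?_
    have hη : eta X * norm2 X = maxAbs X := div_mul_cancel₀ _ hX.ne'
    rw [uThree, hConst, ← hη]
    have hk := kOne_nonneg (Om ω) n v t₁ t₂
    have hη0 : 0 ≤ eta X := div_nonneg (maxAbs_nonneg X) hX.le
    -- The first terms agree exactly; in the second the estimate has only `√(1+ε)`, and the summand
    -- `k₁η` of `U₃` is slack.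
    refine add_le_add (le_of_eq (by ring)) ?_
    refine mul_le_mul_of_nonneg_right (mul_le_mul_of_nonneg_left ?_ (by positivity)) ?_
    · exact le_add_of_nonneg_right (mul_nonneg hk hη0)
    · positivity
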